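/- Let $I_6=\{1,\dots,6\}$ and let $a_1,\dots,a_6\in\mathbb R^6$ satisfy $a_i^Ta_i=\tfrac43$ and $a_i^Ta_j=\tfrac13$ for $i\ne j$. Let $\mathsf E_6$ be the root lattice realized as the dual of the lattice generated by $a_1,\dots,a_6$ and $h=\tfrac13\sum_{i}a_i$, and let $\mathcal E=\{e_1,\dots,e_6\}$ be the basis dual to $a_1,\dots,a_6$. Let $P=P_V(\mathsf E_6)=\{x\in\mathbb R^6: v^Tx\le\tfrac12 v^Tv \text{ for all } v\in\mathsf E_6\setminus\{0\}\}$ be the Voronoi polytope, and put $F(s)=P\cap(P+s)$; a vector $s\in\mathsf E_6$ is a *facet vector* if $F(s)$ is a facet of $P$. A *6-belt* of $P$ is a set of six distinct facets that can be numbered $F_1,\dots,F_6$ (indices mod 6) so that, for each $i$, $F_i\cap F_{i+1}$ and $F_i\cap F_{i-1}$ are antipodal $4$-dimensional faces of $F_i$. A triple $r,r',r''$ of facet vectors, considered up to order and up to the sign of each member, *generates* the 6-belt $\{F(\pm r),F(\pm r'),F(\pm r'')\}$ if this set is a 6-belt. For $S\subseteq I_6$ write $e(S)=\sum_{i\in S}e_i$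 and $\overline S=I_6\setminus S$. Then $P_V(\mathsf E_6)$ has exactly $120$ 6-belts. All vectors in the following triples are facet vectors, and each 6-belt is generated by exactly one of these triples, each of which generates a 6-belt: (i) $e_i-e_j,\ e_j-e_k,\ e_k-e_i$, with $i,j,k\in I_6$ distinct ($20$ triples); (ii) $e(S),\ e(\overline S),\ e(I_6)$, with $S\subseteq I_6$, $|S|=3$ ($10$ triples); (iii) $e(S),\ e_i-e_j,\ e(S)-e_i+e_j$, with $S\subseteq I_6$, $|S|=3$, $i\in S$, $j\notin S$ ($90$ triples). No triple belongs to two of the three families. -/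

import Mathlib

open scoped Pointwise

noncomputable section

section Polytopes

variable {V : Type*} [NormedAddCommGroup V] [InnerProductSpace ℝ V]

/-- The dimension of (the affine hull of) a set. -/
def affDim (A : Set V) : ℕ := Module.finrank ℝ (vectorSpan ℝ A)

/-- `G` is a nonempty face of the convex set `P`: the set of maximisers on `P` of a
linear functional. -/
def IsFaceOf (P G : Set V) : Prop := G.Nonempty ∧ IsExposed ℝ P G

/-- A facet of `P`: a face of codimension one. -/
def IsFacetOf (P F : Set V) : Prop := IsFaceOf P F ∧ affDim F + 1 = affDim P

/-- `G` and `G'` are antipodal in `F`: `F` has a centre of symmetry `c`, and the reflection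
in `c` carries `G` to `G'`. -/
def AreAntipodalIn (F G G' : Set V) : Prop :=
  ∃ c : V, Equiv.pointReflection c '' F = F ∧ Equiv.pointReflection c '' G = G'

/-- The set `B` of facets is a `k`-belt of the polytope `P`: it consists of `k` distinct facets
which can be cyclically numbered `F i`, `i` modulo `k`, in such a way that `F i ∩ F (i + 1)` and
`F i ∩ F (i - 1)` are antipodal faces of `F i` of codimension two in `P`. -/
def IsBelt (P : Set V) (k : ℕ) (B : Set (Set V)) : Prop :=
  ∃ F : ZMod k → Set V, Function.Injective F ∧ Set.range F = B ∧
    ∀ i, IsFacetOf P (F i) ∧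
      IsFaceOf (F i) (F i ∩ F (i + 1)) ∧ affDim (F i ∩ F (i + 1)) + 2 = affDim P ∧
      IsFaceOf (F i) (F i ∩ F (i - 1)) ∧ affDim (F i ∩ F (i - 1)) + 2 = affDim P ∧
      AreAntipodalIn (F i) (F i ∩ F (i + 1)) (F i ∩ F (i - 1))

/-- The Voronoi polytope of a lattice. -/
def voronoiPolytope (L : Submodule ℤ V) : Set V :=
  {x | ∀ v ∈ L, v ≠ 0 → inner ℝ v x ≤ (1 / 2) * inner ℝ v v}

/-- The common part `F(s)` of the Voronoi polytope and its translate by `s`. -/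
def sharedFace (L : Submodule ℤ V) (s : V) : Set V :=
  voronoiPolytope L ∩ (s +ᵥ voronoiPolytope L)

/-- `s` is a facet vector: a lattice vector such that the Voronoi polytope and its translate
by `s` share a facet. -/
def IsFacetVector (L : Submodule ℤ V) (s : V) : Prop :=
  s ∈ L ∧ IsFacetOf (voronoiPolytope L) (sharedFace L s)

/-- A triple of vectors, regarded up to order and up to the signs of its members. -/
def signedTriple (r r' r'' : V) : Set V := {r, -r, r', -r', r'', -r''}

/-- The set of facets `F(±r), F(±r'), F(±r'')` attached to a triple. -/
def generatedFacets (L : Submodule ℤ V) (T : Set V) : Set (Set V) := sharedFace L '' T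

/-- The lattice generated by `a₁, …, a₆` and `h = (a₁ + ⋯ + a₆) / 3`. -/
def latticeE6Dual (a : Fin 6 → V) : Submodule ℤ V :=
  Submodule.span ℤ (Set.range a ∪ {(1 / 3 : ℝ) • ∑ i, a i})

/-- The lattice `E₆`: the dual of the preceding lattice, that is, all vectors having integral
inner products with all its elements. -/
def latticeE6 (a : Fin 6 → V) : Submodule ℤ V :=
  LinearMap.BilinForm.dualSubmodule (innerₗ V) (latticeE6Dual a)

/-- `e(S) = ∑_{i ∈ S} e_i`. -/
def eSum (e : Fin 6 → V) (S : Finset (Fin 6)) : V := ∑ i ∈ S, e i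

/-- Triples `e_i - e_j, e_j - e_k, e_k - e_i`. -/
def triplesI (e : Fin 6 → V) : Set (Set V) :=
  {T | ∃ i j k : Fin 6, i ≠ j ∧ j ≠ k ∧ k ≠ i ∧
    T = signedTriple (e i - e j) (e j - e k) (e k - e i)}

/-- Triples `e(S), e(S̄), e(I₆)`. -/
def triplesII (e : Fin 6 → V) : Set (Set V) :=
  {T | ∃ S : Finset (Fin 6), S.card = 3 ∧
    T = signedTriple (eSum e S) (eSum e Sᶜ) (eSum e Finset.univ)}

/-- Triples `e(S), e_i - e_j, e(S) - e_i + e_j`. -/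
def triplesIII (e : Fin 6 → V) : Set (Set V) :=
  {T | ∃ (S : Finset (Fin 6)) (i j : Fin 6), S.card = 3 ∧ i ∈ S ∧ j ∉ S ∧
    T = signedTriple (eSum e S) (e i - e j) (eSum e S - e i + e j)}

end Polytopes

end

/-! The belts are read off from the roots (norm-two vectors) of the lattice. If every nonzero
lattice vector v has product at least 2 with some root r, then passing from v to v - r lowers the
norm by at least 2, and by induction the Voronoi inequality of v is a sum of inequalities (r, x) ≤ 1
for roots. So the polytope is cut out by its roots; each root r gives a facet F(r), centrally
symmetric about r/2, and root and facet determine each other.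

Let F(s), F(r), F(t) be consecutive in a belt. The reflection x ↦ r - x exchanges the two ridges of
F(r), so r, s and t are all constant on F(r) ∩ F(s), which has codimension two; hence t is a
combination of r and s. Solving for the coefficients leaves t = r - s with (r, t) = 1, or t = -s
with (r, t) = 0 (`belt_step`). The second case propagates backwards and closes the belt after four
facets, so a 6-belt is a hexagon ±r, ±s, ±(r - s) with (r, s) = 1; conversely each such hexagon
gives a 6-belt.

For E₆, `exists_rootsE6` finds in an explicit list of vectors one having product at least 2 with a
given nonzero lattice vector. This supplies the hypothesis above and also shows that the list
contains all roots. It remains to sort the pairs of roots with product 1 into the three families and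
to count: 20 + 10 + 90. -/

noncomputable section

/-! ### Facets of the Voronoi polytope of a root lattice. -/

section RootLattices

variable {V : Type*} [NormedAddCommGroup V] [InnerProductSpace ℝ V]

/-- The roots of a lattice: its vectors of norm two. -/
def latticeRoots (L : Submodule ℤ V) : Set V := {r | r ∈ L ∧ inner ℝ r r = 2}

/-- An integral lattice of full rank in which every nonzero vector has inner product at least two with
some root. -/
structure IsRootLattice (L : Submodule ℤ V) : Prop where
  integral : ∀ u ∈ L, ∀ v ∈ L, ∃ n : ℤ, inner ℝ u v = n
  exists_root : ∀ v ∈ L, v ≠ 0 → ∃ r ∈ latticeRoots L, 2 ≤ inner ℝ r v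
  finite_roots : (latticeRoots L).Finite
  eq_zero_of_orthogonal : ∀ t, (∀ r ∈ latticeRoots L, inner ℝ r t = 0) → t = 0

variable {L : Submodule ℤ V}

lemma ne_zero_of_mem_latticeRoots {r : V} (hr : r ∈ latticeRoots L) : r ≠ 0 := by
  rintro rfl
  have := hr.2
  simp at this

lemma neg_mem_latticeRoots {r : V} (hr : r ∈ latticeRoots L) : -r ∈ latticeRoots L :=
  ⟨L.neg_mem hr.1, by simpa using hr.2⟩

lemma inner_sub_self_eq (u v : V) :
    inner ℝ (u - v) (u - v) = inner ℝ u u - 2 * inner ℝ u v + inner ℝ v v := by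
  rw [inner_sub_sub_self]
  simp [real_inner_comm u v]; ring

lemma inner_add_self_eq (u v : V) :
    inner ℝ (u + v) (u + v) = inner ℝ u u + 2 * inner ℝ u v + inner ℝ v v := by
  rw [inner_add_add_self]
  simp [real_inner_comm u v]; ring

/-- The norm of r - s is 4 - 2(r, s) ≤ 0. -/
lemma eq_of_two_le_inner {r s : V} (hr : r ∈ latticeRoots L) (hs : s ∈ latticeRoots L)
    (h : 2 ≤ inner ℝ r s) : r = s := by
  have h1 := inner_sub_self_eq r s
  rw [hr.2, hs.2] at h1
  have h2 : inner ℝ (r - s) (r - s) = 0 := le_antisymm (by linarith) real_inner_self_nonneg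
  exact sub_eq_zero.1 (inner_self_eq_zero.1 h2)

lemma sub_mem_latticeRoots {r s : V} (hr : r ∈ latticeRoots L) (hs : s ∈ latticeRoots L)
    (h : inner ℝ r s = 1) : r - s ∈ latticeRoots L :=
  ⟨L.sub_mem hr.1 hs.1, by rw [inner_sub_self_eq, hr.2, hs.2, h]; norm_num⟩

lemma add_mem_latticeRoots {r s : V} (hr : r ∈ latticeRoots L) (hs : s ∈ latticeRoots L)
    (h : inner ℝ r s = -1) : r + s ∈ latticeRoots L :=
  ⟨L.add_mem hr.1 hs.1, by rw [inner_add_self_eq, hr.2, hs.2, h]; norm_num⟩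

/-- The part of the Voronoi polytope shared with its translate by a lattice vector lies on the
bisecting hyperplane. -/
lemma mem_sharedFace_iff {s : V} (hs : s ∈ L) {x : V} :
    x ∈ sharedFace L s ↔ x ∈ voronoiPolytope L ∧ inner ℝ s x = (1 / 2) * inner ℝ s s := by
  by_cases h0 : s = 0
  · subst h0
    simp [sharedFace]
  simp only [sharedFace, Set.mem_inter_iff, Set.mem_vadd_set_iff_neg_vadd_mem, vadd_eq_add]
  refine and_congr_right fun hx => ⟨fun hy => ?_, fun h v hv hv0 => ?_⟩
  · have h1 := hx s hs h0
    have h2 := hy (-s) (L.neg_mem hs) (neg_ne_zero.2 h0)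
    simp only [inner_neg_left, inner_neg_right, inner_add_right, neg_neg] at h2
    linarith
  · by_cases hvs : v + s = 0
    · obtain rfl : v = -s := eq_neg_of_add_eq_zero_left hvs
      simp only [inner_neg_left, inner_neg_right, inner_add_right, neg_neg]
      linarith
    -- Given (s, x) = (s, s)/2, the inequality of v at x - s is the inequality of v + s at x.
    · have h1 := hx (v + s) (L.add_mem hv hs) hvs
      rw [inner_add_self_eq, inner_add_left] at h1
      rw [inner_add_right, inner_neg_right]
      linarith

lemma mem_sharedFace_root {r : V} (hr : r ∈ latticeRoots L) {x : V} :
    x ∈ sharedFace L r ↔ x ∈ voronoiPolytope L ∧ inner ℝ r x = 1 := by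
  rw [mem_sharedFace_iff hr.1, hr.2]
  norm_num

lemma inner_root_le_one {r x : V} (hr : r ∈ latticeRoots L) (hx : x ∈ voronoiPolytope L) :
    inner ℝ r x ≤ 1 := by
  have := hx r hr.1 (ne_zero_of_mem_latticeRoots hr)
  rw [hr.2] at this
  linarith

lemma convex_voronoiPolytope (L : Submodule ℤ V) : Convex ℝ (voronoiPolytope L) := by
  intro x hx y hy a b ha hb hab v hv hv0
  rw [inner_add_right, inner_smul_right, inner_smul_right]
  have h1 := hx v hv hv0
  have h2 := hy v hv hv0
  calc a * inner ℝ v x + b * inner ℝ v y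
      ≤ a * (1 / 2 * inner ℝ v v) + b * (1 / 2 * inner ℝ v v) := by gcongr
    _ = 1 / 2 * inner ℝ v v := by rw [← add_mul, hab, one_mul]

/-- A set which lies in a translate of a subspace and contains a relative neighbourhood of one of
its points there spans that subspace. -/
lemma vectorSpan_eq_of_ball_subset {A : Set V} {W : Submodule ℝ V} {x₀ : V} {ε : ℝ} (hε : 0 < ε)
    (hA : ∀ y ∈ A, y - x₀ ∈ W) (hball : ∀ w ∈ W, ‖w‖ ≤ ε → x₀ + w ∈ A) :
    vectorSpan ℝ A = W := by
  apply le_antisymm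
  · rw [vectorSpan_def, Submodule.span_le]
    rintro _ ⟨y, hy, z, hz, rfl⟩
    have := W.sub_mem (hA y hy) (hA z hz)
    simpa using this
  · intro w hw
    have hc : 0 < ε / (‖w‖ + 1) := by positivity
    have h1 : x₀ + (ε / (‖w‖ + 1)) • w ∈ A := by
      refine hball _ (W.smul_mem _ hw) ?_
      rw [norm_smul, Real.norm_of_nonneg hc.le, div_mul_eq_mul_div, div_le_iff₀ (by positivity)]
      gcongr
      linarith
    have h0 : x₀ ∈ A := by simpa using hball 0 W.zero_mem (by simpa using hε.le)
    have h2 := vsub_mem_vectorSpan ℝ h1 h0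
    rw [vsub_eq_sub, add_sub_cancel_left] at h2
    exact (Submodule.smul_mem_iff _ hc.ne').1 h2

namespace IsRootLattice

variable (hL : IsRootLattice L)
include hL

lemma inner_le_one_of_ne {r s : V} (hr : r ∈ latticeRoots L) (hs : s ∈ latticeRoots L)
    (h : r ≠ s) : inner ℝ r s ≤ 1 := by
  obtain ⟨n, hn⟩ := hL.integral r hr.1 s hs.1
  have h1 : ¬ (2 : ℝ) ≤ n := fun h2 => h (eq_of_two_le_inner hr hs (hn ▸ h2))
  have h2 : n ≤ 1 := by
    have : (n : ℝ) < 2 := not_le.1 h1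
    have : n < 2 := by exact_mod_cast this
    omega
  rw [hn]
  exact_mod_cast h2

/-- The Voronoi polytope of a root lattice is cut out by its roots. -/
lemma mem_voronoiPolytope_iff {x : V} :
    x ∈ voronoiPolytope L ↔ ∀ r ∈ latticeRoots L, inner ℝ r x ≤ 1 := by
  refine ⟨fun hx r hr => inner_root_le_one hr hx, fun h => ?_⟩
  -- Induction on an integer bound for the norm. If (r, v) ≥ 2, then (v, x) = (r, x) + (v - r, x) ≤
  -- 1 + (v - r, v - r)/2 ≤ (v, v)/2.
  have key : ∀ n : ℕ, ∀ v ∈ L, inner ℝ v v ≤ (n : ℝ) → inner ℝ v x ≤ (1 / 2) * inner ℝ v v := by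
    intro n
    induction n with
    | zero =>
      intro v _ hn
      have : v = 0 := inner_self_eq_zero.1 (le_antisymm (by simpa using hn) real_inner_self_nonneg)
      simp [this]
    | succ n ih =>
      intro v hv hn
      by_cases h0 : v = 0
      · simp [h0]
      obtain ⟨r, hr, hrv⟩ := hL.exists_root v hv h0
      have h1 := inner_sub_self_eq v r
      rw [hr.2, real_inner_comm r v] at h1
      have h2 := ih (v - r) (L.sub_mem hv hr.1) (by push_cast at hn; linarith)
      rw [inner_sub_left] at h2
      have h3 := h r hr
      linarith
  intro v hv _
  obtain ⟨n, hn⟩ := exists_nat_ge (inner ℝ v v)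
  exact key n v hv hn

/-- A root has length √2 < 5/3, so a displacement of length at most 1/5 changes its value by at most
1/3, the slack between 2/3 and 1. Roots that are tight at the base point are kept under control by
orthogonality to w. -/
lemma add_mem_voronoiPolytope {x₀ w : V} (hx : ∀ r ∈ latticeRoots L,
    (inner ℝ r x₀ ≤ 1 ∧ inner ℝ r w = 0) ∨ inner ℝ r x₀ ≤ 2 / 3) (hw : ‖w‖ ≤ 1 / 5) :
    x₀ + w ∈ voronoiPolytope L := by
  rw [hL.mem_voronoiPolytope_iff]
  intro r hr
  rw [inner_add_right]
  rcases hx r hr with ⟨h1, h2⟩ | h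
  · linarith
  · have h1 : ‖r‖ ≤ 5 / 3 := by
      have h2 := hr.2
      rw [real_inner_self_eq_norm_sq] at h2
      nlinarith [norm_nonneg r]
    have h2 : inner ℝ r w ≤ 5 / 3 * (1 / 5) :=
      (real_inner_le_norm r w).trans (mul_le_mul h1 hw (norm_nonneg _) (by norm_num))
    linarith

lemma vectorSpan_voronoiPolytope : vectorSpan ℝ (voronoiPolytope L) = ⊤ := by
  refine vectorSpan_eq_of_ball_subset (x₀ := 0) (ε := 1 / 5) (by norm_num) (fun _ _ => trivial) ?_
  intro w _ hw
  refine hL.add_mem_voronoiPolytope (fun r _ => Or.inr ?_) hw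
  norm_num

lemma half_root_mem_sharedFace {r : V} (hr : r ∈ latticeRoots L) :
    (1 / 2 : ℝ) • r ∈ sharedFace L r := by
  rw [mem_sharedFace_root hr, hL.mem_voronoiPolytope_iff]
  refine ⟨fun s hs => ?_, by rw [inner_smul_right, hr.2]; norm_num⟩
  rw [inner_smul_right]
  by_cases h : s = r
  · rw [h, hr.2]; norm_num
  · have := hL.inner_le_one_of_ne hs hr h
    linarith

/-- The centre r/2 of F(r) lies in F(s) only if (s, r) = 2. -/
lemma sharedFace_injOn : Set.InjOn (sharedFace L) (latticeRoots L) := by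
  intro r hr s hs h
  have h1 : (1 / 2 : ℝ) • r ∈ sharedFace L s := h ▸ hL.half_root_mem_sharedFace hr
  rw [mem_sharedFace_root hs, inner_smul_right] at h1
  exact (eq_of_two_le_inner hs hr (by linarith [h1.2])).symm

lemma vectorSpan_sharedFace {r : V} (hr : r ∈ latticeRoots L) :
    vectorSpan ℝ (sharedFace L r) = (Submodule.span ℝ {r})ᗮ := by
  refine vectorSpan_eq_of_ball_subset (x₀ := (1 / 2 : ℝ) • r) (ε := 1 / 5) (by norm_num) ?_ ?_
  · intro y hy
    rw [mem_sharedFace_root hr] at hy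
    rw [Submodule.mem_orthogonal_singleton_iff_inner_right, inner_sub_right, hy.2, inner_smul_right,
      hr.2]
    norm_num
  · intro w hw hε
    rw [Submodule.mem_orthogonal_singleton_iff_inner_right] at hw
    rw [mem_sharedFace_root hr, inner_add_right, inner_smul_right, hr.2, hw]
    refine ⟨hL.add_mem_voronoiPolytope (fun s hs => ?_) hε, by norm_num⟩
    rw [inner_smul_right]
    by_cases h : s = r
    · rw [h, hr.2, hw]; norm_num
    · have := hL.inner_le_one_of_ne hs hr h
      right; linarith

/-- The point (r + s)/3 has product 1 with r and s, and at most (1 + 1)/3 = 2/3 with every other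
root. It is therefore a relatively interior point of the ridge. -/
lemma third_sum_mem_sharedFace_inter {r s : V} (hr : r ∈ latticeRoots L) (hs : s ∈ latticeRoots L)
    (h : inner ℝ r s = 1) {w : V} (hrw : inner ℝ r w = 0) (hsw : inner ℝ s w = 0)
    (hw : ‖w‖ ≤ 1 / 5) : (1 / 3 : ℝ) • (r + s) + w ∈ sharedFace L r ∩ sharedFace L s := by
  have h' : inner ℝ s r = 1 := by rw [real_inner_comm, h]
  have hP : (1 / 3 : ℝ) • (r + s) + w ∈ voronoiPolytope L := by
    refine hL.add_mem_voronoiPolytope (fun t ht => ?_) hw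
    rw [inner_smul_right, inner_add_right]
    by_cases htr : t = r
    · rw [htr, hr.2, h, hrw]; norm_num
    by_cases hts : t = s
    · rw [hts, hs.2, h', hsw]; norm_num
    have h1 := hL.inner_le_one_of_ne ht hr htr
    have h2 := hL.inner_le_one_of_ne ht hs hts
    right; linarith
  refine ⟨(mem_sharedFace_root hr).2 ⟨hP, ?_⟩, (mem_sharedFace_root hs).2 ⟨hP, ?_⟩⟩
  · rw [inner_add_right, inner_smul_right, inner_add_right, hr.2, h, hrw]; norm_num
  · rw [inner_add_right, inner_smul_right, inner_add_right, hs.2, h', hsw]; norm_num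

lemma vectorSpan_sharedFace_inter {r s : V} (hr : r ∈ latticeRoots L) (hs : s ∈ latticeRoots L)
    (h : inner ℝ r s = 1) :
    vectorSpan ℝ (sharedFace L r ∩ sharedFace L s) = (Submodule.span ℝ {r, s})ᗮ := by
  have h' : inner ℝ s r = 1 := by rw [real_inner_comm, h]
  have hmem : ∀ w, w ∈ (Submodule.span ℝ {r, s})ᗮ ↔ inner ℝ r w = 0 ∧ inner ℝ s w = 0 := by
    intro w
    rw [Submodule.span_insert, ← Submodule.inf_orthogonal, Submodule.mem_inf,
      Submodule.mem_orthogonal_singleton_iff_inner_right,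
      Submodule.mem_orthogonal_singleton_iff_inner_right]
  refine vectorSpan_eq_of_ball_subset (x₀ := (1 / 3 : ℝ) • (r + s)) (ε := 1 / 5) (by norm_num) ?_ ?_
  · rintro y ⟨hyr, hys⟩
    rw [mem_sharedFace_root hr] at hyr
    rw [mem_sharedFace_root hs] at hys
    rw [hmem, inner_sub_right, inner_sub_right, hyr.2, hys.2, inner_smul_right, inner_smul_right,
      inner_add_right, inner_add_right, hr.2, hs.2, h, h']
    norm_num
  · intro w hw hε
    rw [hmem] at hw
    exact hL.third_sum_mem_sharedFace_inter hr hs h hw.1 hw.2 hε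

lemma affDim_voronoiPolytope : affDim (voronoiPolytope L) = Module.finrank ℝ V := by
  rw [affDim, hL.vectorSpan_voronoiPolytope, finrank_top]

variable [FiniteDimensional ℝ V]

lemma affDim_sharedFace {r : V} (hr : r ∈ latticeRoots L) :
    affDim (sharedFace L r) + 1 = affDim (voronoiPolytope L) := by
  rw [hL.affDim_voronoiPolytope, affDim, hL.vectorSpan_sharedFace hr,
    ← Submodule.finrank_add_finrank_orthogonal (Submodule.span ℝ {r}),
    finrank_span_singleton (ne_zero_of_mem_latticeRoots hr), add_comm]

lemma affDim_sharedFace_inter {r s : V} (hr : r ∈ latticeRoots L) (hs : s ∈ latticeRoots L)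
    (h : inner ℝ r s = 1) :
    affDim (sharedFace L r ∩ sharedFace L s) + 2 = affDim (voronoiPolytope L) := by
  have hli : LinearIndependent ℝ ![r, s] := by
    rw [LinearIndependent.pair_iff]
    intro a b hab
    have h1 : inner ℝ r (a • r + b • s) = 0 := by rw [hab, inner_zero_right]
    have h2 : inner ℝ s (a • r + b • s) = 0 := by rw [hab, inner_zero_right]
    simp only [inner_add_right, inner_smul_right, hr.2, hs.2, h, real_inner_comm r s] at h1 h2
    constructor <;> linarith
  have h2 : Module.finrank ℝ (Submodule.span ℝ {r, s}) = 2 := by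
    have := finrank_span_eq_card hli
    rwa [Matrix.range_cons_cons_empty, Fintype.card_fin] at this
  rw [hL.affDim_voronoiPolytope, affDim, hL.vectorSpan_sharedFace_inter hr hs h,
    ← Submodule.finrank_add_finrank_orthogonal (Submodule.span ℝ {r, s}), h2, add_comm]

lemma isFacetOf_sharedFace {r : V} (hr : r ∈ latticeRoots L) :
    IsFacetOf (voronoiPolytope L) (sharedFace L r) := by
  refine ⟨⟨⟨_, hL.half_root_mem_sharedFace hr⟩, fun hne => ⟨innerSL ℝ r, ?_⟩⟩,
    hL.affDim_sharedFace hr⟩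
  ext x
  simp only [Set.mem_ofPred_eq, innerSL_apply_apply, mem_sharedFace_root hr]
  refine and_congr_right fun hx => ⟨fun h y hy => h ▸ inner_root_le_one hr hy, fun h => ?_⟩
  have h1 := (mem_sharedFace_root hr).1 (hL.half_root_mem_sharedFace hr)
  exact le_antisymm (inner_root_le_one hr hx) (h1.2 ▸ h _ h1.1)

/-- Every facet of the Voronoi polytope of a root lattice comes from a root. -/
lemma exists_root_of_isFacetOf {F : Set V} (hF : IsFacetOf (voronoiPolytope L) F) :
    ∃ r ∈ latticeRoots L, F = sharedFace L r := by
  obtain ⟨⟨hne, hexp⟩, hdim⟩ := hF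
  have hconv : Convex ℝ F := hexp.convex (convex_voronoiPolytope L)
  obtain ⟨l, hl⟩ := hexp hne
  have hFP : F ⊆ voronoiPolytope L := hexp.subset
  -- If no root were tight on all of F, averaging finitely many points of F would give a point where
  -- every root inequality is strict, hence an interior point of the polytope. The exposing
  -- functional has a maximum there, so it is zero and F is the whole polytope, against the
  -- dimension.
  obtain ⟨r, hr, hrF⟩ : ∃ r ∈ latticeRoots L, ∀ x ∈ F, inner ℝ r x = 1 := by
    by_contra! hcon
    have hlt : ∀ r ∈ latticeRoots L, ∃ x ∈ F, inner ℝ r x < 1 := fun r hr => by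
      obtain ⟨x, hx, hx1⟩ := hcon r hr
      exact ⟨x, hx, lt_of_le_of_ne (inner_root_le_one hr (hFP hx)) hx1⟩
    obtain ⟨x, hxF, hx⟩ : ∃ x ∈ F, ∀ r ∈ latticeRoots L, inner ℝ r x < 1 := by
      have key : ∀ R : Set V, R.Finite → R ⊆ latticeRoots L →
          ∃ x ∈ F, ∀ r ∈ R, inner ℝ r x < 1 := by
        intro R hR
        induction R, hR using Set.Finite.induction_on with
        | empty => exact fun _ => ⟨hne.some, hne.some_mem, by simp⟩
        | @insert s R _ _ ih =>
          intro hsub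
          obtain ⟨x, hxF, hx⟩ := ih ((Set.subset_insert s R).trans hsub)
          obtain ⟨y, hyF, hy⟩ := hlt s (hsub (Set.mem_insert s R))
          refine ⟨(1 / 2 : ℝ) • x + (1 / 2 : ℝ) • y,
            hconv hxF hyF (by norm_num) (by norm_num) (by norm_num), fun r hr => ?_⟩
          rw [inner_add_right, inner_smul_right, inner_smul_right]
          have h1 := inner_root_le_one (hsub hr) (hFP hxF)
          have h2 := inner_root_le_one (hsub hr) (hFP hyF)
          rcases hr with rfl | hr
          · linarith
          · linarith [hx r hr]
      exact key _ hL.finite_roots subset_rfl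
    have hnhds : ∀ᶠ y in nhds x, y ∈ voronoiPolytope L := by
      have : ∀ᶠ y in nhds x, ∀ r ∈ latticeRoots L, inner ℝ r y < 1 := by
        rw [Filter.eventually_all_finite hL.finite_roots]
        intro r hr
        exact (continuous_const.inner continuous_id).continuousAt.eventually_lt
          continuousAt_const (hx r hr)
      filter_upwards [this] with y hy
      exact hL.mem_voronoiPolytope_iff.2 fun r hr => (hy r hr).le
    have hmax : IsLocalMax l x := by
      rw [hl] at hxF
      filter_upwards [hnhds] with y hy using hxF.2 y hy
    have hl0 : l = 0 := by
      have := hmax.fderiv_eq_zero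
      rwa [l.fderiv] at this
    have : F = voronoiPolytope L := by
      rw [hl]
      simp [hl0]
    rw [this] at hdim
    omega
  refine ⟨r, hr, ?_⟩
  have hsub : F ⊆ sharedFace L r := fun x hx => (mem_sharedFace_root hr).2 ⟨hFP hx, hrF x hx⟩
  have hspan : vectorSpan ℝ F = vectorSpan ℝ (sharedFace L r) := by
    refine Submodule.eq_of_le_of_finrank_eq (vectorSpan_mono ℝ hsub) ?_
    have := hL.affDim_sharedFace hr
    unfold affDim at this hdim
    omega
  -- The functional exposing F is constant on F, hence also on F(r), which has the same direction
  -- space; so all of F(r) maximises it.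
  have hker : vectorSpan ℝ F ≤ LinearMap.ker (l : V →ₗ[ℝ] ℝ) := by
    rw [vectorSpan_def, Submodule.span_le]
    rintro _ ⟨y, hy, z, hz, rfl⟩
    rw [hl] at hy hz
    simp [le_antisymm (hz.2 y hy.1) (hy.2 z hz.1)]
  refine hsub.antisymm fun y hy => ?_
  obtain ⟨x, hx⟩ := hne
  have h1 : y - x ∈ LinearMap.ker (l : V →ₗ[ℝ] ℝ) :=
    hker (hspan ▸ vsub_mem_vectorSpan ℝ hy (hsub hx))
  have h2 : l y = l x := by simpa [sub_eq_zero] using h1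
  rw [hl] at hx ⊢
  exact ⟨((mem_sharedFace_root hr).1 hy).1, fun z hz => h2 ▸ hx.2 z hz⟩

end IsRootLattice

end RootLattices


/-! ### Belts of length six as hexagons of roots. -/

section RootLatticeBelts

variable {V : Type*} [NormedAddCommGroup V]

/-- The cycle of roots of a plane hexagonal subsystem. -/
def rootHexagon (r s : V) : ZMod 6 → V := ![r, s, s - r, -r, -s, r - s]

lemma range_rootHexagon (r s : V) : Set.range (rootHexagon r s) = signedTriple r s (r - s) := by
  ext x
  simp only [Set.mem_range, signedTriple, Set.mem_insert_iff, Set.mem_singleton_iff, neg_sub]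
  constructor
  · rintro ⟨i, rfl⟩
    fin_cases i <;> simp [rootHexagon]
  · rintro (rfl | rfl | rfl | rfl | rfl | rfl)
    exacts [⟨0, rfl⟩, ⟨3, rfl⟩, ⟨1, rfl⟩, ⟨4, rfl⟩, ⟨5, rfl⟩, ⟨2, rfl⟩]

lemma forall_zmod_six {p : ZMod 6 → Prop} (h0 : p 0) (h1 : p 1) (h2 : p 2) (h3 : p 3) (h4 : p 4)
    (h5 : p 5) : ∀ i, p i := by
  intro i
  fin_cases i <;> assumption

/-- The uniform recursion treats all six facets of the belt at once, and it is the relation that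
`belt_step` yields in the hexagonal case. -/
lemma rootHexagon_succ (r s : V) (i : ZMod 6) :
    rootHexagon r s (i + 1) = rootHexagon r s i - rootHexagon r s (i - 1) := by
  revert i
  apply forall_zmod_six
  · change s = r - (r - s); abel
  · change s - r = s - r; abel
  · change -r = s - r - s; abel
  · change -s = -r - (s - r); abel
  · change r - s = -s - (-r); abel
  · change r = r - s - (-s); abel

variable [InnerProductSpace ℝ V] {L : Submodule ℤ V}

lemma pointReflection_half_smul (r y : V) :
    Equiv.pointReflection ((1 / 2 : ℝ) • r) y = r - y := by
  rw [Equiv.pointReflection_apply, vsub_eq_sub, vadd_eq_add]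
  module

/-- The functional s exposes the intersection. Nonemptiness ensures that its maximum on F(r) is
really 1. -/
lemma isFaceOf_sharedFace_inter {r s : V} (hs : s ∈ latticeRoots L)
    (hne : (sharedFace L r ∩ sharedFace L s).Nonempty) :
    IsFaceOf (sharedFace L r) (sharedFace L r ∩ sharedFace L s) := by
  refine ⟨hne, fun hne => ⟨innerSL ℝ s, ?_⟩⟩
  obtain ⟨z, hzr, hzs⟩ := hne
  ext x
  simp only [Set.mem_ofPred_eq, innerSL_apply_apply, Set.mem_inter_iff]
  refine and_congr_right fun hx => ⟨fun h y hy => ?_, fun h => ?_⟩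
  · rw [((mem_sharedFace_root hs).1 h).2]
    exact inner_root_le_one hs hy.1
  · refine (mem_sharedFace_root hs).2 ⟨hx.1, le_antisymm (inner_root_le_one hs hx.1) ?_⟩
    rw [← ((mem_sharedFace_root hs).1 hzs).2]
    exact h z hzr

lemma rootHexagon_mem {r s : V} (hr : r ∈ latticeRoots L) (hs : s ∈ latticeRoots L)
    (h : inner ℝ r s = 1) (i : ZMod 6) : rootHexagon r s i ∈ latticeRoots L := by
  have hrs := sub_mem_latticeRoots hr hs h
  have hsr := neg_mem_latticeRoots hrs
  rw [neg_sub] at hsr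
  revert i
  exact forall_zmod_six hr hs hsr (neg_mem_latticeRoots hr) (neg_mem_latticeRoots hs) hrs

lemma inner_rootHexagon_succ {r s : V} (hr : r ∈ latticeRoots L) (hs : s ∈ latticeRoots L)
    (h : inner ℝ r s = 1) (i : ZMod 6) :
    inner ℝ (rootHexagon r s i) (rootHexagon r s (i + 1)) = 1 := by
  have hr2 := hr.2
  have hs2 := hs.2
  have h' : inner ℝ s r = 1 := by rw [real_inner_comm, h]
  revert i
  apply forall_zmod_six
  · change inner ℝ r s = 1; exact h
  · change inner ℝ s (s - r) = 1; rw [inner_sub_right]; linarith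
  · change inner ℝ (s - r) (-r) = 1; rw [inner_neg_right, inner_sub_left]; linarith
  · change inner ℝ (-r) (-s) = 1; rw [inner_neg_neg]; exact h
  · change inner ℝ (-s) (r - s) = 1; rw [inner_neg_left, inner_sub_right]; linarith
  · change inner ℝ (r - s) r = 1; rw [inner_sub_left]; linarith

/-- The values of a linear functional separating the roots of a hexagon. -/
def hexagonHeight : ZMod 6 → ℤ := ![5, 4, -1, -5, -4, 1]

lemma rootHexagon_injective {r s : V} (hr : r ∈ latticeRoots L) (hs : s ∈ latticeRoots L)
    (h : inner ℝ r s = 1) : Function.Injective (rootHexagon r s) := by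
  have key : ∀ i, inner ℝ ((2 : ℝ) • r + s) (rootHexagon r s i) = (hexagonHeight i : ℝ) := by
    have hr2 := hr.2
    have hs2 := hs.2
    have h' : inner ℝ s r = 1 := by rw [real_inner_comm, h]
    apply forall_zmod_six
    · change inner ℝ _ r = ((5 : ℤ) : ℝ)
      rw [inner_add_left, real_inner_smul_left]; push_cast; linarith
    · change inner ℝ _ s = ((4 : ℤ) : ℝ)
      rw [inner_add_left, real_inner_smul_left]; push_cast; linarith
    · change inner ℝ _ (s - r) = ((-1 : ℤ) : ℝ)
      simp only [inner_add_left, real_inner_smul_left, inner_sub_right]; push_cast; linarith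
    · change inner ℝ _ (-r) = ((-5 : ℤ) : ℝ)
      simp only [inner_add_left, real_inner_smul_left, inner_neg_right]; push_cast; linarith
    · change inner ℝ _ (-s) = ((-4 : ℤ) : ℝ)
      simp only [inner_add_left, real_inner_smul_left, inner_neg_right]; push_cast; linarith
    · change inner ℝ _ (r - s) = ((1 : ℤ) : ℝ)
      simp only [inner_add_left, real_inner_smul_left, inner_sub_right]; push_cast; linarith
  have hinj : ∀ i j, hexagonHeight i = hexagonHeight j → i = j := by decide
  intro i j hij
  apply hinj
  have h1 := key i
  rw [hij, key j, Int.cast_inj] at h1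
  exact h1.symm

/-- Three roots constant on a common set of codimension two are linearly dependent. -/
lemma exists_eq_smul_add_smul [FiniteDimensional ℝ V] {r s t : V} {A : Set V} {c : ℝ} (hr : r ∈ latticeRoots L)
    (hs : s ∈ latticeRoots L) (hrs : inner ℝ r s = 0 ∨ inner ℝ r s = 1)
    (hdim : affDim A + 2 = Module.finrank ℝ V)
    (hAr : ∀ y ∈ A, inner ℝ r y = 1) (hAs : ∀ y ∈ A, inner ℝ s y = 1)
    (hAt : ∀ y ∈ A, inner ℝ t y = c) : ∃ α β : ℝ, t = α • r + β • s := by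
  -- Functionals constant on A are orthogonal to its direction space, whose orthogonal complement is
  -- a plane, spanned by r and s.
  have hperp : ∀ u : V, (∃ d : ℝ, ∀ y ∈ A, inner ℝ u y = d) → u ∈ (vectorSpan ℝ A)ᗮ := by
    rintro u ⟨d, hd⟩
    rw [Submodule.mem_orthogonal']
    intro w hw
    have : vectorSpan ℝ A ≤ LinearMap.ker (innerₗ V u) := by
      rw [vectorSpan_def, Submodule.span_le]
      rintro _ ⟨y, hy, z, hz, rfl⟩
      simp [inner_sub_right, hd y hy, hd z hz]
    simpa using this hw
  have hfin : Module.finrank ℝ ((vectorSpan ℝ A)ᗮ : Submodule ℝ V) = 2 := by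
    have := Submodule.finrank_add_finrank_orthogonal (vectorSpan ℝ A)
    unfold affDim at hdim
    omega
  have hli : LinearIndependent ℝ ![r, s] := by
    rw [LinearIndependent.pair_iff]
    intro a b hab
    have h1 : inner ℝ r (a • r + b • s) = 0 := by rw [hab, inner_zero_right]
    have h2 : inner ℝ s (a • r + b • s) = 0 := by rw [hab, inner_zero_right]
    simp only [inner_add_right, inner_smul_right, hr.2, hs.2, real_inner_comm r s] at h1 h2
    rcases hrs with h | h <;> rw [h] at h1 h2 <;> constructor <;> linarith
  have hspan : Submodule.span ℝ {r, s} = (vectorSpan ℝ A)ᗮ := by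
    refine Submodule.eq_of_le_of_finrank_eq ?_ ?_
    · rw [Submodule.span_le]
      rintro u (rfl | rfl)
      exacts [hperp _ ⟨1, hAr⟩, hperp _ ⟨1, hAs⟩]
    · have := finrank_span_eq_card hli
      rw [Matrix.range_cons_cons_empty, Fintype.card_fin] at this
      rw [hfin, this]
  have ht : t ∈ Submodule.span ℝ {r, s} := hspan ▸ hperp t ⟨c, hAt⟩
  obtain ⟨α, β, h⟩ := Submodule.mem_span_pair.1 ht
  exact ⟨α, β, h.symm⟩

namespace IsRootLattice

variable (hL : IsRootLattice L)
include hL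

lemma third_sum_mem_inter {r s : V} (hr : r ∈ latticeRoots L) (hs : s ∈ latticeRoots L)
    (h : inner ℝ r s = 1) : (sharedFace L r ∩ sharedFace L s).Nonempty :=
  ⟨_, hL.third_sum_mem_sharedFace_inter hr hs h (w := 0) (by simp) (by simp) (by simp)⟩

/-- Central symmetry of F(r) about r/2. For a root s ≠ r the bound (s, r - x) ≤ 1 comes from the
root -s when (s, r) ≤ 0, and from the root r - s when (s, r) = 1. -/
lemma sub_mem_voronoiPolytope {r x : V} (hr : r ∈ latticeRoots L) (hx : x ∈ sharedFace L r) :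
    r - x ∈ sharedFace L r := by
  rw [mem_sharedFace_root hr] at hx ⊢
  refine ⟨?_, by rw [inner_sub_right, hr.2, hx.2]; norm_num⟩
  rw [hL.mem_voronoiPolytope_iff]
  intro s hs
  rw [inner_sub_right]
  by_cases h : s = r
  · rw [h, hr.2, hx.2]; norm_num
  obtain ⟨n, hn⟩ := hL.integral s hs.1 r hr.1
  have hle := hL.inner_le_one_of_ne hs hr h
  have h1 := inner_root_le_one (neg_mem_latticeRoots hs) hx.1
  rw [inner_neg_left] at h1
  by_cases h2 : inner ℝ s r ≤ 0
  · linarith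
  · have h3 : inner ℝ s r = 1 := by
      rw [hn] at hle h2 ⊢
      norm_cast at *
      omega
    have h4 := inner_root_le_one (neg_mem_latticeRoots (sub_mem_latticeRoots hs hr h3)) hx.1
    rw [neg_sub, inner_sub_left, hx.2] at h4
    linarith

lemma image_pointReflection_sharedFace {r : V} (hr : r ∈ latticeRoots L) :
    Equiv.pointReflection ((1 / 2 : ℝ) • r) '' sharedFace L r = sharedFace L r := by
  ext x
  simp only [Set.mem_image, pointReflection_half_smul]
  constructor
  · rintro ⟨y, hy, rfl⟩
    exact hL.sub_mem_voronoiPolytope hr hy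
  · intro hx
    exact ⟨r - x, hL.sub_mem_voronoiPolytope hr hx, by abel⟩

lemma areAntipodalIn_sharedFace {r s : V} (hr : r ∈ latticeRoots L) (hs : s ∈ latticeRoots L)
    (h : inner ℝ r s = 1) :
    AreAntipodalIn (sharedFace L r) (sharedFace L r ∩ sharedFace L s)
      (sharedFace L r ∩ sharedFace L (r - s)) := by
  have hrs := sub_mem_latticeRoots hr hs h
  refine ⟨(1 / 2 : ℝ) • r, hL.image_pointReflection_sharedFace hr, ?_⟩
  ext x
  simp only [Set.mem_image, pointReflection_half_smul, Set.mem_inter_iff]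
  have h' : inner ℝ s r = 1 := by rw [real_inner_comm, h]
  constructor
  · rintro ⟨y, ⟨hyr, hys⟩, rfl⟩
    refine ⟨hL.sub_mem_voronoiPolytope hr hyr, (mem_sharedFace_root hrs).2
      ⟨(hL.sub_mem_voronoiPolytope hr hyr).1, ?_⟩⟩
    rw [mem_sharedFace_root hr] at hyr
    rw [mem_sharedFace_root hs] at hys
    simp only [inner_sub_left, inner_sub_right, hyr.2, hys.2, hr.2, h']
    norm_num
  · rintro ⟨hxr, hxs⟩
    refine ⟨r - x, ⟨hL.sub_mem_voronoiPolytope hr hxr, (mem_sharedFace_root hs).2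
      ⟨(hL.sub_mem_voronoiPolytope hr hxr).1, ?_⟩⟩, by abel⟩
    rw [mem_sharedFace_root hr] at hxr
    rw [mem_sharedFace_root hrs, inner_sub_left] at hxs
    rw [inner_sub_right, h']
    linarith [hxs.2, hxr.2]

/-- A facet of the Voronoi polytope has at most one centre of symmetry. -/
lemma eq_half_smul_of_image_pointReflection {r c : V} (hr : r ∈ latticeRoots L)
    (hc : Equiv.pointReflection c '' sharedFace L r = sharedFace L r) :
    c = (1 / 2 : ℝ) • r := by
  -- Composing the reflections in r/2 and in c gives the translation by 2c - r, which preserves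
  -- F(r). Its iterates stay where every root is at most 1, so no root is positive on 2c - r; by
  -- symmetry all roots vanish on it.
  have hstep : ∀ x ∈ sharedFace L r, x + ((2 : ℝ) • c - r) ∈ sharedFace L r := by
    intro x hx
    rw [← hc]
    refine ⟨r - x, hL.sub_mem_voronoiPolytope hr hx, ?_⟩
    rw [Equiv.pointReflection_apply, vsub_eq_sub, vadd_eq_add]
    module
  have hiter : ∀ n : ℕ, (1 / 2 : ℝ) • r + (n : ℝ) • ((2 : ℝ) • c - r) ∈ sharedFace L r := by
    intro n
    induction n with
    | zero => simpa using hL.half_root_mem_sharedFace hr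
    | succ n ih =>
      have := hstep _ ih
      rw [Nat.cast_add, Nat.cast_one, add_smul, one_smul, ← add_assoc]
      exact this
  have hle : ∀ s ∈ latticeRoots L, inner ℝ s ((2 : ℝ) • c - r) ≤ 0 := by
    intro s hs
    by_contra! hpos
    obtain ⟨n, hn⟩ := exists_nat_gt ((1 - inner ℝ s ((1 / 2 : ℝ) • r)) /
      inner ℝ s ((2 : ℝ) • c - r))
    rw [div_lt_iff₀ hpos] at hn
    have := inner_root_le_one hs (hiter n).1
    rw [inner_add_right, inner_smul_right _ _ (n : ℝ)] at this
    linarith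
  have hzero := hL.eq_zero_of_orthogonal ((2 : ℝ) • c - r) fun s hs => by
    refine le_antisymm (hle s hs) ?_
    have := hle (-s) (neg_mem_latticeRoots hs)
    rw [inner_neg_left] at this
    linarith
  have : (2 : ℝ) • c = r := sub_eq_zero.1 hzero
  rw [← this]
  module

/-- Distinct roots whose facets meet have inner product zero or one. -/
lemma inner_eq_zero_or_one {r s y : V} (hr : r ∈ latticeRoots L) (hs : s ∈ latticeRoots L)
    (hne : r ≠ s) (hyr : y ∈ sharedFace L r) (hys : y ∈ sharedFace L s) :
    inner ℝ r s = 0 ∨ inner ℝ r s = 1 := by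
  rw [mem_sharedFace_root hr] at hyr
  rw [mem_sharedFace_root hs] at hys
  -- Product -2 would mean s = -r, while r and s both take the value 1 at y. Product -1 would make r
  -- + s a root with value 2 at y.
  obtain ⟨n, hn⟩ := hL.integral r hr.1 s hs.1
  have h1 := hL.inner_le_one_of_ne hr hs hne
  have h2 : -r ≠ s := by
    rintro rfl
    have := hys.2
    rw [inner_neg_left, hyr.2] at this
    norm_num at this
  have h3 := hL.inner_le_one_of_ne (neg_mem_latticeRoots hr) hs h2
  have h4 : inner ℝ r s ≠ -1 := fun h => by
    have := inner_root_le_one (add_mem_latticeRoots hr hs h) hyr.1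
    rw [inner_add_left, hyr.2, hys.2] at this
    norm_num at this
  rw [inner_neg_left] at h3
  rw [hn] at h1 h3 h4 ⊢
  have h3' : -n ≤ 1 := by exact_mod_cast h3
  have h1' : n ≤ 1 := by exact_mod_cast h1
  have h4' : n ≠ -1 := by exact_mod_cast h4
  have : n = 0 ∨ n = 1 := by omega
  exact_mod_cast this

variable [FiniteDimensional ℝ V]

/-- Two roots with inner product one generate a 6-belt. -/
lemma isBelt_generatedFacets {r s : V} (hr : r ∈ latticeRoots L) (hs : s ∈ latticeRoots L)
    (h : inner ℝ r s = 1) :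
    IsBelt (voronoiPolytope L) 6 (generatedFacets L (signedTriple r s (r - s))) := by
  refine ⟨fun i => sharedFace L (rootHexagon r s i), ?_, ?_, ?_⟩
  · intro i j hij
    exact rootHexagon_injective hr hs h
      (hL.sharedFace_injOn (rootHexagon_mem hr hs h i) (rootHexagon_mem hr hs h j) hij)
  · rw [generatedFacets, ← range_rootHexagon, ← Set.range_comp]
    rfl
  · intro i
    have hi := rootHexagon_mem hr hs h i
    have hi1 := rootHexagon_mem hr hs h (i + 1)
    have hi2 := rootHexagon_mem hr hs h (i - 1)
    have h1 := inner_rootHexagon_succ hr hs h i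
    have h2 := inner_rootHexagon_succ hr hs h (i - 1)
    rw [sub_add_cancel, real_inner_comm] at h2
    have h3 : rootHexagon r s (i - 1) = rootHexagon r s i - rootHexagon r s (i + 1) := by
      rw [rootHexagon_succ]; abel
    refine ⟨hL.isFacetOf_sharedFace hi,
      isFaceOf_sharedFace_inter hi1 (hL.third_sum_mem_inter hi hi1 h1),
      hL.affDim_sharedFace_inter hi hi1 h1,
      isFaceOf_sharedFace_inter hi2 (hL.third_sum_mem_inter hi hi2 h2),
      hL.affDim_sharedFace_inter hi hi2 h2, ?_⟩
    simp only [h3]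
    exact hL.areAntipodalIn_sharedFace hi hi1 h1

/-- The local structure of a belt: consecutive roots either form a hexagon or a square. -/
lemma belt_step {r s t : V} (hr : r ∈ latticeRoots L) (hs : s ∈ latticeRoots L)
    (ht : t ∈ latticeRoots L) (hrs : r ≠ s) (hrt : r ≠ t)
    (hne : (sharedFace L r ∩ sharedFace L t).Nonempty)
    (hdim : affDim (sharedFace L r ∩ sharedFace L s) + 2 = affDim (voronoiPolytope L))
    (hanti : AreAntipodalIn (sharedFace L r) (sharedFace L r ∩ sharedFace L t)
      (sharedFace L r ∩ sharedFace L s)) :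
    (inner ℝ r t = 1 ∧ t = r - s) ∨ (inner ℝ r t = 0 ∧ t = -s) := by
  obtain ⟨c, hc, hG⟩ := hanti
  obtain rfl := hL.eq_half_smul_of_image_pointReflection hr hc
  -- Such a y is r - z with z in the opposite ridge, where t takes the value 1.
  have hAt : ∀ y ∈ sharedFace L r ∩ sharedFace L s, inner ℝ t y = inner ℝ r t - 1 := by
    intro y hy
    rw [← hG] at hy
    obtain ⟨z, hz, rfl⟩ := hy
    rw [pointReflection_half_smul, inner_sub_right, real_inner_comm,
      ((mem_sharedFace_root ht).1 hz.2).2]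
  obtain ⟨z, hzr, hzt⟩ := hne
  have hy : r - z ∈ sharedFace L r ∩ sharedFace L s := by
    rw [← hG]
    exact ⟨z, ⟨hzr, hzt⟩, pointReflection_half_smul r z⟩
  have hrt' := hL.inner_eq_zero_or_one hr ht hrt hzr hzt
  have hrs' := hL.inner_eq_zero_or_one hr hs hrs hy.1 hy.2
  rw [hL.affDim_voronoiPolytope] at hdim
  obtain ⟨α, β, hαβ⟩ := exists_eq_smul_add_smul hr hs hrs' hdim
    (fun y hy => ((mem_sharedFace_root hr).1 hy.1).2)
    (fun y hy => ((mem_sharedFace_root hs).1 hy.2).2) hAt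
  -- Pairing t = αr + βs with a point of the ridge, with r and with itself gives three equations.
  -- The first two determine α and β in each of the four cases; the norm equation kills the two
  -- mixed ones.
  have e1 : inner ℝ t (r - z) = α + β := by
    rw [hαβ, inner_add_left, real_inner_smul_left, real_inner_smul_left,
      ((mem_sharedFace_root hr).1 hy.1).2, ((mem_sharedFace_root hs).1 hy.2).2]
    ring
  rw [hAt _ hy] at e1
  have e2 : inner ℝ r t = 2 * α + β * inner ℝ r s := by
    rw [hαβ, inner_add_right, inner_smul_right, inner_smul_right, hr.2]
    ring
  have e3 : (2 : ℝ) = 2 * α ^ 2 + 2 * α * β * inner ℝ r s + 2 * β ^ 2 := by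
    have h := ht.2
    rw [hαβ, inner_add_self_eq] at h
    simp only [real_inner_smul_left, inner_smul_right, hr.2, hs.2] at h
    linarith
  rcases hrt' with h1 | h1 <;> rcases hrs' with h2 | h2 <;> rw [h1] at e1 e2 <;>
    rw [h2] at e2 e3
  · obtain rfl : α = 0 := by linarith
    obtain rfl : β = -1 := by linarith
    exact Or.inr ⟨h1, by rw [hαβ]; module⟩
  · obtain rfl : α = 1 := by linarith
    obtain rfl : β = -2 := by linarith
    norm_num at e3
  · obtain rfl : α = 1 / 2 := by linarith
    obtain rfl : β = -1 / 2 := by linarith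
    norm_num at e3
  · obtain rfl : α = 1 := by linarith
    obtain rfl : β = -1 := by linarith
    exact Or.inl ⟨h1, by rw [hαβ]; module⟩

/-- Every 6-belt of the Voronoi polytope of a root lattice is generated by two roots with inner
product one and their difference. -/
lemma exists_generatedFacets_eq_of_isBelt {B : Set (Set V)}
    (hB : IsBelt (voronoiPolytope L) 6 B) :
    ∃ r ∈ latticeRoots L, ∃ s ∈ latticeRoots L, inner ℝ r s = 1 ∧
      B = generatedFacets L (signedTriple r s (r - s)) := by
  obtain ⟨F, hinj, hrange, hF⟩ := hB
  choose f hf hFf using fun i => hL.exists_root_of_isFacetOf (hF i).1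
  obtain rfl : F = fun i => sharedFace L (f i) := funext hFf
  have hne : ∀ i j, i ≠ j → f i ≠ f j := fun i j hij h => hij (hinj (congrArg (sharedFace L) h))
  have hsucc : ∀ i : ZMod 6, i ≠ i + 1 := by decide
  have hpred : ∀ i : ZMod 6, i ≠ i - 1 := by decide
  have step : ∀ i, (inner ℝ (f i) (f (i + 1)) = 1 ∧ f (i + 1) = f i - f (i - 1)) ∨
      (inner ℝ (f i) (f (i + 1)) = 0 ∧ f (i + 1) = -f (i - 1)) := fun i => by
    obtain ⟨-, hface, -, -, hdim, hanti⟩ := hF i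
    exact hL.belt_step (hf i) (hf (i - 1)) (hf (i + 1)) (hne _ _ (hpred i)) (hne _ _ (hsucc i))
      hface.1 hdim hanti
  have hprop0 : ∀ i, inner ℝ (f i) (f (i + 1)) = 0 → inner ℝ (f (i - 1)) (f i) = 0 := by
    intro i hi
    rcases step i with ⟨h, -⟩ | ⟨-, h⟩
    · rw [hi] at h
      norm_num at h
    · rw [h, inner_neg_right, real_inner_comm] at hi
      linarith
  -- A zero product propagates two places back, giving f (i + 1) = -f (i - 1) = f (i - 3), although
  -- i + 1 ≠ i - 3 modulo 6.
  have hnz : ∀ i, inner ℝ (f i) (f (i + 1)) ≠ 0 := by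
    intro i hi
    have e : ∀ i : ZMod 6, i - 1 - 1 + 1 = i - 1 ∧ i + 1 ≠ i - 1 - 1 - 1 := by decide
    have h1 : f (i + 1) = -f (i - 1) := by
      rcases step i with ⟨h, -⟩ | ⟨-, h⟩
      · rw [hi] at h
        norm_num at h
      · exact h
    have h2 := hprop0 i hi
    rw [← sub_add_cancel i 1, add_sub_cancel_right] at h2
    have h3 := hprop0 _ h2
    have h4 : f (i - 1) = -f (i - 1 - 1 - 1) := by
      rcases step (i - 1 - 1) with ⟨h, -⟩ | ⟨-, h⟩
      · rw [(e i).1, h3] at h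
        norm_num at h
      · rwa [(e i).1] at h
    exact hne _ _ (e i).2 (by rw [h1, h4, neg_neg])
  have hall : ∀ i, f (i + 1) = f i - f (i - 1) := fun i =>
    (step i).elim (fun h => h.2) fun h => absurd h.1 (hnz i)
  have h0 : inner ℝ (f 0) (f 1) = 1 :=
    (step 0).elim (fun h => h.1) fun h => absurd h.1 (hnz 0)
  refine ⟨f 0, hf 0, f 1, hf 1, h0, ?_⟩
  have h2 : f 2 = f 1 - f 0 := hall 1
  have h3 : f 3 = -f 0 := by
    have : f 3 = f 2 - f 1 := hall 2
    rw [this, h2]; abel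
  have h4 : f 4 = -f 1 := by
    have : f 4 = f 3 - f 2 := hall 3
    rw [this, h2, h3]; abel
  have h5 : f 5 = f 0 - f 1 := by
    have : f 5 = f 4 - f 3 := hall 4
    rw [this, h4, h3]; abel
  have hhex : f = rootHexagon (f 0) (f 1) :=
    funext (forall_zmod_six rfl rfl h2 h3 h4 h5)
  rw [← hrange, generatedFacets, ← range_rootHexagon, ← hhex, ← Set.range_comp]
  rfl

end IsRootLattice

end RootLatticeBelts


/-! ### The lattice E₆ in the basis e and its roots. -/

section LatticeE6

/-- The pairs of bases of the statement: `a` has the given Gram matrix and `e` is dual to `a`. -/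
structure IsE6Pair (a e : Fin 6 → EuclideanSpace ℝ (Fin 6)) : Prop where
  gram : ∀ i j, inner ℝ (a i) (a j) = if i = j then (4 / 3 : ℝ) else 1 / 3
  dual : ∀ i j, inner ℝ (e i) (a j) = if i = j then (1 : ℝ) else 0

/-- The vectors `e_i - e_j`, `± e(S)` with `|S| = 3`, and `± e(I₆)`. -/
def rootsE6 (e : Fin 6 → EuclideanSpace ℝ (Fin 6)) : Set (EuclideanSpace ℝ (Fin 6)) :=
  {v | (∃ i j, i ≠ j ∧ v = e i - e j) ∨ (∃ S : Finset (Fin 6), S.card = 3 ∧ v = eSum e S) ∨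
    (∃ S : Finset (Fin 6), S.card = 3 ∧ v = -eSum e S) ∨ v = eSum e Finset.univ ∨
    v = -eSum e Finset.univ}

namespace IsE6Pair

variable {a e : Fin 6 → EuclideanSpace ℝ (Fin 6)} (h : IsE6Pair a e)
include h

lemma linearIndependent : LinearIndependent ℝ e := by
  rw [Fintype.linearIndependent_iff]
  intro c hc j
  have h1 : inner ℝ (∑ i, c i • e i) (a j) = (0 : ℝ) := by rw [hc, inner_zero_left]
  simpa [sum_inner, real_inner_smul_left, h.dual] using h1

lemma eq_sum (v : EuclideanSpace ℝ (Fin 6)) : v = ∑ i, inner ℝ v (a i) • e i := by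
  have hspan : v ∈ Submodule.span ℝ (Set.range e) := by
    rw [h.linearIndependent.span_eq_top_of_card_eq_finrank (by simp)]
    trivial
  obtain ⟨c, rfl⟩ := (Submodule.mem_span_range_iff_exists_fun ℝ).1 hspan
  refine Finset.sum_congr rfl fun j _ => ?_
  congr 1
  simp [sum_inner, real_inner_smul_left, h.dual]

lemma a_eq (j : Fin 6) : a j = e j + (1 / 3 : ℝ) • eSum e Finset.univ := by
  conv_lhs => rw [h.eq_sum (a j)]
  have h1 : ∀ i, inner ℝ (a j) (a i) • e i = (if j = i then e i else 0) + (1 / 3 : ℝ) • e i := by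
    intro i
    rw [h.gram]
    split_ifs <;> module
  simp only [h1, Finset.sum_add_distrib, eSum, Finset.smul_sum]
  simp

lemma inner_e_eSum_univ (i : Fin 6) : inner ℝ (e i) (eSum e Finset.univ) = (1 / 3 : ℝ) := by
  have h1 : ∑ j, inner ℝ (e i) (a j) = (1 : ℝ) := by simp [h.dual]
  simp only [h.a_eq, inner_add_right, inner_smul_right, Finset.sum_add_distrib, ← inner_sum] at h1
  simp only [Finset.sum_const, Finset.card_univ, Fintype.card_fin, nsmul_eq_mul] at h1
  change inner ℝ (e i) (eSum e Finset.univ) + _ = _ at h1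
  push_cast at h1
  linarith

/-- The Gram matrix of a is I + J/3, with J the all-ones matrix of size 6; its inverse is I - J/9.
-/
lemma inner_e_e (i j : Fin 6) : inner ℝ (e i) (e j) = (if i = j then (1 : ℝ) else 0) - 1 / 9 := by
  rw [← h.dual i j, h.a_eq j, inner_add_right, inner_smul_right, h.inner_e_eSum_univ]
  ring

lemma inner_e_sum (i : Fin 6) (x : Fin 6 → ℝ) :
    inner ℝ (e i) (∑ j, x j • e j) = x i - (∑ j, x j) / 9 := by
  simp [inner_sum, inner_smul_right, h.inner_e_e, mul_sub, Finset.sum_sub_distrib, Finset.sum_mul,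
    div_eq_mul_inv]

lemma inner_eSum_sum (S : Finset (Fin 6)) (x : Fin 6 → ℝ) :
    inner ℝ (eSum e S) (∑ j, x j • e j) = ∑ i ∈ S, x i - S.card * (∑ j, x j) / 9 := by
  simp only [eSum, sum_inner, h.inner_e_sum, Finset.sum_sub_distrib, Finset.sum_const, nsmul_eq_mul]
  ring

lemma inner_eSum_eSum (S T : Finset (Fin 6)) :
    inner ℝ (eSum e S) (eSum e T) = ((S ∩ T).card : ℝ) - S.card * T.card / 9 := by
  have h1 : eSum e T = ∑ j, (if j ∈ T then (1 : ℝ) else 0) • e j := by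
    simp [eSum, Finset.sum_ite_mem]
  rw [h1, h.inner_eSum_sum]
  simp [Finset.sum_ite_mem]

lemma inner_sub_eSum (i j : Fin 6) (T : Finset (Fin 6)) :
    inner ℝ (e i - e j) (eSum e T) =
      (if i ∈ T then (1 : ℝ) else 0) - (if j ∈ T then (1 : ℝ) else 0) := by
  have h1 : eSum e T = ∑ j, (if j ∈ T then (1 : ℝ) else 0) • e j := by
    simp [eSum, Finset.sum_ite_mem]
  rw [h1, inner_sub_left, h.inner_e_sum, h.inner_e_sum]
  ring

lemma inner_sub_sub (i j k l : Fin 6) :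
    inner ℝ (e i - e j) (e k - e l) =
      (if i = k then (1 : ℝ) else 0) - (if i = l then 1 else 0) - (if j = k then 1 else 0)
        + (if j = l then 1 else 0) := by
  simp only [inner_sub_left, inner_sub_right, h.inner_e_e]
  ring

lemma inner_eSum_a (S : Finset (Fin 6)) (k : Fin 6) :
    inner ℝ (eSum e S) (a k) = if k ∈ S then (1 : ℝ) else 0 := by
  simp [eSum, sum_inner, h.dual]

lemma inner_sub_a (i j k : Fin 6) :
    inner ℝ (e i - e j) (a k) = (if i = k then (1 : ℝ) else 0) - if j = k then 1 else 0 := by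
  rw [inner_sub_left, h.dual, h.dual]

/-- Pairing with the a_i reads off the coordinates, and pairing with h gives a third of their sum.
-/
lemma mem_latticeE6_iff {v : EuclideanSpace ℝ (Fin 6)} :
    v ∈ latticeE6 a ↔ ∃ (x : Fin 6 → ℤ) (m : ℤ), ∑ i, x i = 3 * m ∧ v = ∑ i, (x i : ℝ) • e i := by
  have hmem : v ∈ latticeE6 a ↔ (∀ i, ∃ n : ℤ, (n : ℝ) = inner ℝ v (a i)) ∧
      ∃ m : ℤ, (m : ℝ) = inner ℝ v ((1 / 3 : ℝ) • ∑ i, a i) := by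
    rw [latticeE6, LinearMap.BilinForm.mem_dualSubmodule]
    constructor
    · intro hv
      refine ⟨fun i => ?_, ?_⟩
      · have := hv (a i) (Submodule.subset_span (Or.inl ⟨i, rfl⟩))
        simpa [Submodule.mem_one] using this
      · have := hv _ (Submodule.subset_span (Or.inr rfl))
        rw [Submodule.mem_one] at this
        exact this
    · rintro ⟨h1, h2⟩ y hy
      induction hy using Submodule.span_induction with
      | mem y hy =>
        rw [Submodule.mem_one]
        rcases hy with ⟨i, rfl⟩ | rfl
        · exact h1 i
        · exact h2
      | zero => simp
      | add y z _ _ hy hz =>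
        rw [map_add]
        exact Submodule.add_mem _ hy hz
      | smul n y _ hy =>
        rw [map_zsmul]
        exact Submodule.smul_mem _ n hy
  rw [hmem]
  simp only [inner_smul_right, inner_sum]
  constructor
  · rintro ⟨h1, m, hm⟩
    choose x hx using h1
    refine ⟨x, m, ?_, ?_⟩
    · simp only [← hx] at hm
      have : (∑ i, (x i : ℝ)) = 3 * m := by linarith
      exact_mod_cast this
    · simp only [hx]
      exact h.eq_sum v
  · rintro ⟨x, m, hm, rfl⟩
    have hx : ∀ j, inner ℝ (∑ i, (x i : ℝ) • e i) (a j) = (x j : ℝ) := fun j => by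
      simp [sum_inner, real_inner_smul_left, h.dual]
    refine ⟨fun i => ⟨x i, (hx i).symm⟩, m, ?_⟩
    simp only [hx]
    have : (∑ i, (x i : ℝ)) = 3 * m := by exact_mod_cast hm
    rw [this]
    ring

/-- Integrality: the correction term -(3m)(3k)/9 is -mk. -/
lemma inner_eq_of_mem {x y : Fin 6 → ℤ} {m k : ℤ} (hx : ∑ i, x i = 3 * m)
    (hy : ∑ i, y i = 3 * k) :
    inner ℝ (∑ i, (x i : ℝ) • e i) (∑ i, (y i : ℝ) • e i) =
      ((∑ i, x i * y i - m * k : ℤ) : ℝ) := by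
  simp only [sum_inner, real_inner_smul_left, h.inner_e_sum, mul_sub, Finset.sum_sub_distrib,
    ← Finset.sum_mul]
  have hx' : (∑ i, (x i : ℝ)) = 3 * m := by exact_mod_cast hx
  have hy' : (∑ i, (y i : ℝ)) = 3 * k := by exact_mod_cast hy
  rw [hx', hy']
  push_cast
  ring

lemma eSum_mem_latticeE6 {S : Finset (Fin 6)} {m : ℕ} (hS : S.card = 3 * m) :
    eSum e S ∈ latticeE6 a := by
  rw [h.mem_latticeE6_iff]
  refine ⟨fun i => if i ∈ S then 1 else 0, m, ?_, ?_⟩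
  · simp [Finset.sum_ite_mem, hS]
  · simp [eSum, Finset.sum_ite_mem]

lemma sub_mem_latticeE6 (i j : Fin 6) : e i - e j ∈ latticeE6 a := by
  rw [h.mem_latticeE6_iff]
  refine ⟨fun k => (if i = k then 1 else 0) - if j = k then 1 else 0, 0, ?_, ?_⟩
  · simp [Finset.sum_sub_distrib]
  · simp [sub_smul, Finset.sum_sub_distrib]

lemma sub_mem_latticeRoots {i j : Fin 6} (hij : i ≠ j) :
    e i - e j ∈ latticeRoots (latticeE6 a) := by
  refine ⟨h.sub_mem_latticeE6 i j, ?_⟩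
  rw [h.inner_sub_sub]
  simp [hij, hij.symm]
  norm_num

lemma eSum_mem_latticeRoots {S : Finset (Fin 6)} (hS : S.card = 3) :
    eSum e S ∈ latticeRoots (latticeE6 a) := by
  refine ⟨h.eSum_mem_latticeE6 (m := 1) hS, ?_⟩
  rw [h.inner_eSum_eSum, Finset.inter_self, hS]
  norm_num

lemma eSum_univ_mem_latticeRoots : eSum e Finset.univ ∈ latticeRoots (latticeE6 a) := by
  refine ⟨h.eSum_mem_latticeE6 (m := 2) (by simp), ?_⟩
  rw [h.inner_eSum_eSum, Finset.inter_self, Finset.card_univ, Fintype.card_fin]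
  norm_num

lemma rootsE6_subset : rootsE6 e ⊆ latticeRoots (latticeE6 a) := by
  rintro v (⟨i, j, hij, rfl⟩ | ⟨S, hS, rfl⟩ | ⟨S, hS, rfl⟩ | rfl | rfl)
  exacts [h.sub_mem_latticeRoots hij, h.eSum_mem_latticeRoots hS,
    neg_mem_latticeRoots (h.eSum_mem_latticeRoots hS), h.eSum_univ_mem_latticeRoots,
    neg_mem_latticeRoots h.eSum_univ_mem_latticeRoots]

/-- Suppose all products are below 2. The differences e_i - e_j force the coordinates to be c + 1 on
a set S and c elsewhere, with |S| < 6. Since the coordinate sum 3m is 6c + |S|, |S| is 0 or 3. If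
|S| = 0, then m = 2c, and ±e(I₆) give |m| < 2, so v = 0. If |S| = 3, then m = 2c + 1, and e(S) gives
c < 0 while -e(S̄) gives c > -1. -/
lemma exists_rootsE6 {v : EuclideanSpace ℝ (Fin 6)} (hv : v ∈ latticeE6 a) (h0 : v ≠ 0) :
    ∃ r ∈ rootsE6 e, 2 ≤ inner ℝ r v := by
  obtain ⟨x, m, hm, rfl⟩ := h.mem_latticeE6_iff.1 hv
  have hm' : (∑ i, (x i : ℝ)) = 3 * m := by exact_mod_cast hm
  by_contra! hcon
  have hS : ∀ S : Finset (Fin 6), inner ℝ (eSum e S) (∑ i, (x i : ℝ) • e i) =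
      ∑ i ∈ S, (x i : ℝ) - S.card * m / 3 := fun S => by
    rw [h.inner_eSum_sum, hm']; ring
  have h1 : ∀ i j, x i ≤ x j + 1 := by
    intro i j
    by_cases hij : i = j
    · rw [hij]; omega
    have := hcon (e i - e j) (Or.inl ⟨i, j, hij, rfl⟩)
    rw [inner_sub_left, h.inner_e_sum, h.inner_e_sum] at this
    have : (x i : ℝ) < x j + 2 := by linarith
    have : x i < x j + 2 := by exact_mod_cast this
    omega
  have h2 : ∀ S : Finset (Fin 6), S.card = 3 → ∑ i ∈ S, x i - m < 2 ∧ -(∑ i ∈ S, x i - m) < 2 := by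
    intro S hS3
    have e1 := hcon _ (Or.inr (Or.inl ⟨S, hS3, rfl⟩))
    have e2 := hcon _ (Or.inr (Or.inr (Or.inl ⟨S, hS3, rfl⟩)))
    rw [inner_neg_left] at e2
    rw [hS, hS3] at e1 e2
    constructor
    · have : (∑ i ∈ S, (x i : ℝ)) - m < 2 := by push_cast at e1; linarith
      exact_mod_cast this
    · have : -((∑ i ∈ S, (x i : ℝ)) - m) < 2 := by push_cast at e2; linarith
      exact_mod_cast this
  have h3 : m < 2 ∧ -m < 2 := by
    have e1 := hcon _ (Or.inr (Or.inr (Or.inr (Or.inl rfl))))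
    have e2 := hcon _ (Or.inr (Or.inr (Or.inr (Or.inr rfl))))
    rw [inner_neg_left] at e2
    rw [hS, hm', Finset.card_univ, Fintype.card_fin] at e1 e2
    push_cast at e1 e2
    constructor
    · have : (m : ℝ) < 2 := by linarith
      exact_mod_cast this
    · have : -(m : ℝ) < 2 := by linarith
      exact_mod_cast this
  obtain ⟨j, hj⟩ := Finite.exists_min x
  set S : Finset (Fin 6) := Finset.univ.filter fun i => x i = x j + 1 with hSdef
  have hx : ∀ i, x i = x j + if i ∈ S then 1 else 0 := by
    intro i
    have e1 := hj i
    have e2 := h1 i j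
    split_ifs with hi
    · exact (Finset.mem_filter.1 hi).2
    · have : x i ≠ x j + 1 := fun hi' => hi (Finset.mem_filter.2 ⟨Finset.mem_univ _, hi'⟩)
      omega
  have hjS : j ∉ S := by simp [hSdef]
  have hcard : S.card < 6 := by
    have := Finset.card_lt_univ_of_notMem hjS
    simpa using this
  have hsum : ∀ T : Finset (Fin 6), ∑ i ∈ T, x i = T.card * x j + (T ∩ S).card := by
    intro T
    rw [Finset.sum_congr rfl fun i _ => hx i]
    simp [Finset.sum_add_distrib, Finset.sum_ite_mem]
  have hu := hsum Finset.univ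
  rw [hm, Finset.univ_inter, Finset.card_univ, Fintype.card_fin] at hu
  push_cast at hu
  have hc : S.card = 0 ∨ S.card = 3 := by omega
  rcases hc with hc | hc
  · apply h0
    rw [hc] at hu
    have hxj : x j = 0 := by push_cast at hu; omega
    have : S = ∅ := Finset.card_eq_zero.1 hc
    refine Finset.sum_eq_zero fun i _ => ?_
    rw [hx i, hxj, this]
    simp
  · have hc' : Sᶜ.card = 3 := by rw [Finset.card_compl, hc]; rfl
    have e1 := (h2 S hc).1
    have e2 := (h2 Sᶜ hc').2
    rw [hsum, Finset.inter_self, hc] at e1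
    rw [hsum, hc', Finset.inter_comm, Finset.inter_compl, Finset.card_empty] at e2
    rw [hc] at hu
    push_cast at e1 e2 hu
    omega

/-- Applied to a root v, `exists_rootsE6` yields a listed root having product at least 2 with v,
hence equal to v. -/
lemma latticeRoots_eq : latticeRoots (latticeE6 a) = rootsE6 e := by
  refine subset_antisymm (fun v hv => ?_) h.rootsE6_subset
  obtain ⟨r, hr, hrv⟩ := h.exists_rootsE6 hv.1 (ne_zero_of_mem_latticeRoots hv)
  exact eq_of_two_le_inner (h.rootsE6_subset hr) hv hrv ▸ hr

omit h in
lemma finite_rootsE6 (e : Fin 6 → EuclideanSpace ℝ (Fin 6)) : (rootsE6 e).Finite := by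
  refine ((Set.finite_range fun p : Fin 6 × Fin 6 => e p.1 - e p.2).union
    ((Set.finite_range (eSum e)).union (Set.finite_range fun S => -eSum e S))).subset ?_
  rintro v (⟨i, j, -, rfl⟩ | ⟨S, -, rfl⟩ | ⟨S, -, rfl⟩ | rfl | rfl)
  exacts [Or.inl ⟨(i, j), rfl⟩, Or.inr (Or.inl ⟨S, rfl⟩), Or.inr (Or.inr ⟨S, rfl⟩),
    Or.inr (Or.inl ⟨_, rfl⟩), Or.inr (Or.inr ⟨_, rfl⟩)]

lemma isRootLattice : IsRootLattice (latticeE6 a) where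
  integral u hu v hv := by
    obtain ⟨x, m, hm, rfl⟩ := h.mem_latticeE6_iff.1 hu
    obtain ⟨y, k, hk, rfl⟩ := h.mem_latticeE6_iff.1 hv
    exact ⟨_, h.inner_eq_of_mem hm hk⟩
  exists_root v hv h0 := h.latticeRoots_eq ▸ h.exists_rootsE6 hv h0
  finite_roots := h.latticeRoots_eq ▸ finite_rootsE6 e
  eq_zero_of_orthogonal t ht := by
    -- The differences make all (e_i, t) equal; e(I₆) makes their sum zero.
    have h1 : ∀ i, inner ℝ (e i) t = (0 : ℝ) := by
      have e1 : ∀ i j, inner ℝ (e i) t = (inner ℝ (e j) t : ℝ) := fun i j => by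
        by_cases hij : i = j
        · rw [hij]
        have := ht _ (h.sub_mem_latticeRoots hij)
        rwa [inner_sub_left, sub_eq_zero] at this
      intro i
      have := ht _ h.eSum_univ_mem_latticeRoots
      rw [eSum, sum_inner, Finset.sum_congr rfl fun j _ => e1 j i] at this
      simpa using this
    have h2 : inner ℝ (∑ i, inner ℝ t (a i) • e i) t = (0 : ℝ) := by
      simp [sum_inner, real_inner_smul_left, h1]
    rw [← h.eq_sum t] at h2
    exact inner_self_eq_zero.1 h2

end IsE6Pair

end LatticeE6


/-! ### The three families of triples: completeness, counting, disjointness. -/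

section E6Triples

section SignedTriple

variable {V : Type*} [NormedAddCommGroup V]

lemma signedTriple_swap (r s t : V) : signedTriple r s t = signedTriple s r t := by
  ext x; simp only [signedTriple, Set.mem_insert_iff, Set.mem_singleton_iff]; tauto

lemma signedTriple_swap_right (r s t : V) : signedTriple r s t = signedTriple r t s := by
  ext x; simp only [signedTriple, Set.mem_insert_iff, Set.mem_singleton_iff]; tauto

lemma signedTriple_rotate (r s t : V) : signedTriple r s t = signedTriple s t r := by
  ext x; simp only [signedTriple, Set.mem_insert_iff, Set.mem_singleton_iff]; tauto

lemma signedTriple_neg_left (r s t : V) : signedTriple (-r) s t = signedTriple r s t := by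
  ext x; simp only [signedTriple, Set.mem_insert_iff, Set.mem_singleton_iff, neg_neg]; tauto

lemma signedTriple_neg_mid (r s t : V) : signedTriple r (-s) t = signedTriple r s t := by
  ext x; simp only [signedTriple, Set.mem_insert_iff, Set.mem_singleton_iff, neg_neg]; tauto

lemma signedTriple_neg_right (r s t : V) : signedTriple r s (-t) = signedTriple r s t := by
  ext x; simp only [signedTriple, Set.mem_insert_iff, Set.mem_singleton_iff, neg_neg]; tauto

lemma signedTriple_subset_latticeRoots [InnerProductSpace ℝ V] {L : Submodule ℤ V} {r s t : V} (hr : r ∈ latticeRoots L)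
    (hs : s ∈ latticeRoots L) (ht : t ∈ latticeRoots L) : signedTriple r s t ⊆ latticeRoots L := by
  rintro x (rfl | rfl | rfl | rfl | rfl | rfl)
  exacts [hr, neg_mem_latticeRoots hr, hs, neg_mem_latticeRoots hs, ht, neg_mem_latticeRoots ht]

end SignedTriple

/-- All triples of the three families. -/
abbrev triplesE6 (e : Fin 6 → EuclideanSpace ℝ (Fin 6)) : Set (Set (EuclideanSpace ℝ (Fin 6))) :=
  triplesI e ∪ triplesII e ∪ triplesIII e

lemma eSum_add_eSum_compl (e : Fin 6 → EuclideanSpace ℝ (Fin 6)) (S : Finset (Fin 6)) :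
    eSum e S + eSum e Sᶜ = eSum e Finset.univ :=
  Finset.sum_add_sum_compl S e

lemma eSum_insert_erase (e : Fin 6 → EuclideanSpace ℝ (Fin 6)) {S : Finset (Fin 6)} {i j : Fin 6}
    (hi : i ∈ S) (hj : j ∉ S) : eSum e (insert j (S.erase i)) = eSum e S - e i + e j := by
  rw [eSum, Finset.sum_insert (fun h => hj (Finset.mem_of_mem_erase h)),
    Finset.sum_erase_eq_sub hi, eSum]
  abel

lemma exists_exchange {S T : Finset (Fin 6)} (hS : S.card = 3) (hT : T.card = 3)
    (hST : (S ∩ T).card = 2) : ∃ i ∈ S, ∃ j ∉ S, T = insert j (S.erase i) := by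
  revert S T
  decide +kernel

namespace IsE6Pair

variable {a e : Fin 6 → EuclideanSpace ℝ (Fin 6)} (h : IsE6Pair a e)
include h

lemma exists_roots_of_mem_triplesE6 {T : Set (EuclideanSpace ℝ (Fin 6))} (hT : T ∈ triplesE6 e) :
    ∃ r ∈ latticeRoots (latticeE6 a), ∃ s ∈ latticeRoots (latticeE6 a),
      inner ℝ r s = (1 : ℝ) ∧ T = signedTriple r s (r - s) := by
  rcases hT with (⟨i, j, k, hij, hjk, hki, rfl⟩ | ⟨S, hS, rfl⟩) | ⟨S, i, j, hS, hi, hj, rfl⟩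
  · refine ⟨e i - e j, h.sub_mem_latticeRoots hij, e k - e j, h.sub_mem_latticeRoots hjk.symm, ?_, ?_⟩
    · rw [h.inner_sub_sub]
      simp [hij, hki.symm, hjk]
    · rw [← signedTriple_neg_mid _ (e k - e j), ← signedTriple_neg_right _ _ (e i - e j - _)]
      congr 1 <;> abel
  · refine ⟨eSum e Finset.univ, h.eSum_univ_mem_latticeRoots, eSum e S, h.eSum_mem_latticeRoots hS,
      ?_, ?_⟩
    · rw [h.inner_eSum_eSum, Finset.univ_inter, hS, Finset.card_univ, Fintype.card_fin]
      norm_num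
    · rw [← eSum_add_eSum_compl e S, add_sub_cancel_left, ← signedTriple_rotate]
  · have hij : i ≠ j := fun hij => hj (hij ▸ hi)
    refine ⟨eSum e S, h.eSum_mem_latticeRoots hS, e i - e j, h.sub_mem_latticeRoots hij, ?_, ?_⟩
    · rw [real_inner_comm, h.inner_sub_eSum, if_pos hi, if_neg hj, sub_zero]
    · congr 1; abel

lemma signedTriple_sub_eSum_mem {S : Finset (Fin 6)} (hS : S.card = 3) {i j : Fin 6}
    (hin : inner ℝ (e i - e j) (eSum e S) = (1 : ℝ)) :
    signedTriple (eSum e S) (e i - e j) (eSum e S - (e i - e j)) ∈ triplesE6 e := by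
  rw [h.inner_sub_eSum] at hin
  by_cases hi : i ∈ S <;> by_cases hj : j ∈ S <;> simp [hi, hj] at hin
  · exact Or.inr ⟨S, i, j, hS, hi, hj, by rw [← sub_add]⟩
  · norm_num at hin

/-- Two differences give family (i), e(I₆) with e(S) gives (ii), and e(S) with a difference gives
(iii). For 3-sets, (e(S), e(T)) = |S ∩ T| - 1: the value 1 means that T exchanges one element of S,
family (iii), and the value -1 that T is the complement, family (ii). Differences are orthogonal to
e(I₆). -/
lemma signedTriple_mem_of_inner_eq_one {r s : EuclideanSpace ℝ (Fin 6)} (hr : r ∈ rootsE6 e)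
    (hs : s ∈ rootsE6 e) (hin : inner ℝ r s = (1 : ℝ)) :
    signedTriple r s (r - s) ∈ triplesE6 e := by
  have hII : ∀ S : Finset (Fin 6), S.card = 3 →
      signedTriple (eSum e Finset.univ) (eSum e S) (eSum e Finset.univ - eSum e S) ∈
        triplesE6 e := fun S hS => Or.inl (Or.inr ⟨S, hS, by
    rw [← eSum_add_eSum_compl e S, add_sub_cancel_left, signedTriple_rotate]⟩)
  have hBB : ∀ S T : Finset (Fin 6), S.card = 3 → T.card = 3 →
      inner ℝ (eSum e S) (eSum e T) = (1 : ℝ) →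
      signedTriple (eSum e S) (eSum e T) (eSum e S - eSum e T) ∈ triplesE6 e := by
    intro S T hS hT hin
    rw [h.inner_eSum_eSum, hS, hT] at hin
    have h2 : (S ∩ T).card = 2 := by
      have : ((S ∩ T).card : ℝ) = 2 := by push_cast at hin; linarith
      exact_mod_cast this
    obtain ⟨i, hi, j, hj, rfl⟩ := exists_exchange hS hT h2
    refine Or.inr ⟨S, i, j, hS, hi, hj, ?_⟩
    rw [eSum_insert_erase e hi hj, ← signedTriple_rotate, signedTriple_swap]
    congr 1; abel
  have hBB' : ∀ S T : Finset (Fin 6), S.card = 3 → T.card = 3 →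
      inner ℝ (eSum e S) (eSum e T) = (-1 : ℝ) →
      signedTriple (eSum e S) (eSum e T) (eSum e S + eSum e T) ∈ triplesE6 e := by
    intro S T hS hT hin
    rw [h.inner_eSum_eSum, hS, hT] at hin
    have h2 : (S ∩ T).card = 0 := by
      have : ((S ∩ T).card : ℝ) = 0 := by push_cast at hin; linarith
      exact_mod_cast this
    obtain rfl : T = Sᶜ := by
      refine Finset.eq_of_subset_of_card_le (fun x hx => Finset.mem_compl.2 fun hxS => ?_) ?_
      · rw [Finset.card_eq_zero] at h2
        exact Finset.notMem_empty x (h2 ▸ Finset.mem_inter.2 ⟨hxS, hx⟩)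
      · rw [Finset.card_compl, hS, hT]; rfl
    exact Or.inl (Or.inr ⟨S, hS, by rw [eSum_add_eSum_compl]⟩)
  have hnorm : inner ℝ (eSum e Finset.univ) (eSum e Finset.univ) = (2 : ℝ) :=
    h.eSum_univ_mem_latticeRoots.2
  have hAC : ∀ i j, inner ℝ (e i - e j) (eSum e Finset.univ) = (0 : ℝ) := fun i j => by
    simp [h.inner_sub_eSum]
  have hBC : ∀ S : Finset (Fin 6), S.card = 3 →
      inner ℝ (eSum e Finset.univ) (eSum e S) = (1 : ℝ) := fun S hS => by
    rw [h.inner_eSum_eSum, Finset.univ_inter, hS, Finset.card_univ, Fintype.card_fin]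
    norm_num
  -- Exchanging the two roots, or negating both, leaves the signed triple unchanged; this reduces
  -- the case analysis.
  have hswap : ∀ {u v : EuclideanSpace ℝ (Fin 6)}, signedTriple v u (v - u) ∈ triplesE6 e →
      signedTriple u v (u - v) ∈ triplesE6 e := fun {u v} huv => by
    rw [signedTriple_swap, ← signedTriple_neg_right, neg_sub]
    exact huv
  have hneg : ∀ {u v : EuclideanSpace ℝ (Fin 6)}, signedTriple u v (u - v) ∈ triplesE6 e →
      signedTriple (-u) (-v) (-u - -v) ∈ triplesE6 e := fun {u v} huv => by
    rw [signedTriple_neg_left, signedTriple_neg_mid, neg_sub_neg, ← signedTriple_neg_right, neg_sub]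
    exact huv
  have hA : ∀ i j : Fin 6, i ≠ j → ∀ v ∈ rootsE6 e, inner ℝ (e i - e j) v = (1 : ℝ) →
      signedTriple (e i - e j) v (e i - e j - v) ∈ triplesE6 e := by
    rintro i j hij v (⟨k, l, hkl, rfl⟩ | ⟨S, hS, rfl⟩ | ⟨S, hS, rfl⟩ | rfl | rfl) hv
    · rw [h.inner_sub_sub] at hv
      by_cases hik : i = k
      · subst hik
        by_cases hjl : j = l
        · subst hjl
          simp [hij, hij.symm] at hv
        · refine Or.inl (Or.inl ⟨i, j, l, hij, hjl, hkl.symm, ?_⟩)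
          rw [← signedTriple_neg_mid, ← signedTriple_neg_right, signedTriple_swap_right]
          congr 1 <;> abel
      · by_cases hjl : j = l
        · subst hjl
          refine Or.inl (Or.inl ⟨i, j, k, hij, hkl.symm, fun h => hik h.symm, ?_⟩)
          rw [← signedTriple_neg_mid, ← signedTriple_neg_right]
          congr 1 <;> abel
        · exfalso
          simp only [hik, hjl, if_false] at hv
          split_ifs at hv <;> norm_num at hv
    · exact hswap (h.signedTriple_sub_eSum_mem hS hv)
    · have hv' : inner ℝ (e j - e i) (eSum e S) = (1 : ℝ) := by
        rw [← neg_sub, inner_neg_left, ← inner_neg_right]; exact hv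
      have := hneg (hswap (h.signedTriple_sub_eSum_mem hS hv'))
      rwa [neg_sub] at this
    · rw [hAC] at hv; norm_num at hv
    · rw [inner_neg_right, hAC] at hv; norm_num at hv
  have hB : ∀ S : Finset (Fin 6), S.card = 3 → ∀ v ∈ rootsE6 e, inner ℝ (eSum e S) v = (1 : ℝ) →
      signedTriple (eSum e S) v (eSum e S - v) ∈ triplesE6 e := by
    rintro S hS v hv hSv
    have hv0 := hv
    rcases hv with (⟨k, l, hkl, rfl⟩ | ⟨T, hT, rfl⟩ | ⟨T, hT, rfl⟩ | rfl | rfl)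
    · exact h.signedTriple_sub_eSum_mem hS (by rw [real_inner_comm]; exact hSv)
    · exact hBB S T hS hT hSv
    · rw [signedTriple_neg_mid, sub_neg_eq_add]
      exact hBB' S T hS hT (by rw [inner_neg_right] at hSv; linarith)
    · exact hswap (hII S hS)
    · rw [inner_neg_right, real_inner_comm, hBC S hS] at hSv; norm_num at hSv
  have hC : ∀ v ∈ rootsE6 e, inner ℝ (eSum e Finset.univ) v = (1 : ℝ) →
      signedTriple (eSum e Finset.univ) v (eSum e Finset.univ - v) ∈ triplesE6 e := by
    rintro v (⟨k, l, hkl, rfl⟩ | ⟨T, hT, rfl⟩ | ⟨T, hT, rfl⟩ | rfl | rfl) hv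
    · rw [real_inner_comm, hAC] at hv; norm_num at hv
    · exact hII T hT
    · rw [inner_neg_right, hBC T hT] at hv; norm_num at hv
    · rw [hnorm] at hv; norm_num at hv
    · rw [inner_neg_right, hnorm] at hv; norm_num at hv
  have hs' : -s ∈ rootsE6 e := by
    rw [← h.latticeRoots_eq] at hs ⊢
    exact neg_mem_latticeRoots hs
  have hflip : ∀ {u : EuclideanSpace ℝ (Fin 6)}, inner ℝ (-u) s = (1 : ℝ) →
      inner ℝ u (-s) = (1 : ℝ) := fun {u} hu => by
    rw [inner_neg_right, ← inner_neg_left]; exact hu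
  rcases hr with (⟨i, j, hij, rfl⟩ | ⟨S, hS, rfl⟩ | ⟨S, hS, rfl⟩ | rfl | rfl)
  · exact hA i j hij s hs hin
  · exact hB S hS s hs hin
  · simpa only [neg_neg] using hneg (hB S hS (-s) hs' (hflip hin))
  · exact hC s hs hin
  · simpa only [neg_neg] using hneg (hC (-s) hs' (hflip hin))

/-! ### The size of the families -/

lemma eSum_injective : Function.Injective (eSum e) := by
  intro S T hST
  ext k
  have := h.inner_eSum_a S k
  rw [hST, h.inner_eSum_a] at this
  by_cases h1 : k ∈ S <;> by_cases h2 : k ∈ T <;> simp_all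

lemma sub_inj {i j k l : Fin 6} (hij : i ≠ j) (heq : e i - e j = e k - e l) : i = k ∧ j = l := by
  have h1 := h.inner_sub_a i j i
  have h2 := h.inner_sub_a i j j
  rw [heq, h.inner_sub_a] at h1 h2
  constructor
  · by_contra hne
    simp only [hij.symm, Ne.symm hne, if_true, if_false] at h1
    split_ifs at h1 <;> norm_num at h1
  · by_contra hne
    simp only [hij, Ne.symm hne, if_true, if_false] at h2
    split_ifs at h2 <;> norm_num at h2

/-- Pairing with ∑ a_k is a grading: e(S) has degree |S| and differences have degree 0. It tells
apart the types of roots in the counting and disjointness arguments. -/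
lemma inner_eSum_sum_a (S : Finset (Fin 6)) : inner ℝ (eSum e S) (∑ k, a k) = (S.card : ℝ) := by
  simp [inner_sum, h.inner_eSum_a]

lemma inner_sub_sum_a (i j : Fin 6) : inner ℝ (e i - e j) (∑ k, a k) = (0 : ℝ) := by
  simp [inner_sum, h.inner_sub_a]

lemma ncard_triplesI : (triplesI e).ncard = 20 := by
  -- The triple consists of all differences within {i, j, k}, so it corresponds to a 3-subset:
  -- C(6,3) = 20.
  let f : Finset (Fin 6) → Set (EuclideanSpace ℝ (Fin 6)) := fun S =>
    {v | ∃ i ∈ S, ∃ j ∈ S, i ≠ j ∧ v = e i - e j}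
  have hf : ∀ i j k, i ≠ j → j ≠ k → k ≠ i →
      f {i, j, k} = signedTriple (e i - e j) (e j - e k) (e k - e i) := by
    intro i j k hij hjk hki
    ext v
    simp only [f, Set.mem_ofPred_eq, signedTriple, Set.mem_insert_iff, Set.mem_singleton_iff,
      Finset.mem_insert, Finset.mem_singleton, neg_sub]
    constructor
    · rintro ⟨x, (rfl | rfl | rfl), y, (rfl | rfl | rfl), hxy, rfl⟩ <;> simp_all
    · rintro (rfl | rfl | rfl | rfl | rfl | rfl)
      exacts [⟨i, by simp, j, by simp, hij, rfl⟩, ⟨j, by simp, i, by simp, hij.symm, rfl⟩,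
        ⟨j, by simp, k, by simp, hjk, rfl⟩, ⟨k, by simp, j, by simp, hjk.symm, rfl⟩,
        ⟨k, by simp, i, by simp, hki, rfl⟩, ⟨i, by simp, k, by simp, hki.symm, rfl⟩]
  have himage : triplesI e = f '' (Finset.powersetCard 3 Finset.univ : Finset (Finset (Fin 6))) := by
    ext T
    constructor
    · rintro ⟨i, j, k, hij, hjk, hki, rfl⟩
      refine ⟨{i, j, k}, ?_, hf i j k hij hjk hki⟩
      simp [Finset.card_eq_three]
      exact ⟨i, j, hij, k, hki.symm, hjk, rfl⟩
    · rintro ⟨S, hS, rfl⟩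
      obtain ⟨i, j, k, hij, hik, hjk, rfl⟩ := Finset.card_eq_three.1
        (Finset.mem_powersetCard.1 (Finset.mem_coe.1 hS)).2
      exact ⟨i, j, k, hij, hjk, hik.symm, hf i j k hij hjk hik.symm⟩
  have hsub : ∀ S T : Finset (Fin 6), S.card = 3 → f S = f T → S ⊆ T := by
    intro S T hS hST i hi
    obtain ⟨j, hj, hji⟩ := Finset.exists_mem_ne (by omega : 1 < S.card) i
    have hmem : e i - e j ∈ f T := hST ▸ ⟨i, hi, j, hj, hji.symm, rfl⟩
    obtain ⟨k, hk, l, hl, -, heq⟩ := hmem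
    exact (h.sub_inj hji.symm heq).1 ▸ hk
  have hinj : Set.InjOn f (Finset.powersetCard 3 Finset.univ : Finset (Finset (Fin 6))) := by
    intro S hS T hT hST
    have hS3 := (Finset.mem_powersetCard.1 (Finset.mem_coe.1 hS)).2
    have hT3 := (Finset.mem_powersetCard.1 (Finset.mem_coe.1 hT)).2
    exact (hsub S T hS3 hST).antisymm (hsub T S hT3 hST.symm)
  rw [himage, hinj.ncard_image, Set.ncard_coe_finset]
  rfl

lemma ncard_triplesII : (triplesII e).ncard = 10 := by
  -- S and its complement give the same triple; requiring 0 ∈ S picks one of them, leaving C(5,2) =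
  -- 10.
  let A : Finset (Finset (Fin 6)) := (Finset.powersetCard 3 Finset.univ).filter fun S => 0 ∈ S
  let f : Finset (Fin 6) → Set (EuclideanSpace ℝ (Fin 6)) := fun S =>
    signedTriple (eSum e S) (eSum e Sᶜ) (eSum e Finset.univ)
  have hA : ∀ {S}, S ∈ (A : Set (Finset (Fin 6))) ↔ S.card = 3 ∧ 0 ∈ S := by
    intro S
    simp [A]
  have himage : triplesII e = f '' A := by
    ext T
    constructor
    · rintro ⟨S, hS, rfl⟩
      by_cases h0 : 0 ∈ S
      · exact ⟨S, hA.2 ⟨hS, h0⟩, rfl⟩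
      · refine ⟨Sᶜ, hA.2 ⟨by rw [Finset.card_compl, hS]; rfl, by simpa using h0⟩, ?_⟩
        simp only [f, compl_compl]
        exact signedTriple_swap _ _ _
    · rintro ⟨S, hS, rfl⟩
      exact ⟨S, (hA.1 hS).1, rfl⟩
  have hinj : Set.InjOn f A := by
    intro S hS T hT hST
    obtain ⟨hS3, hS0⟩ := hA.1 hS
    obtain ⟨hT3, hT0⟩ := hA.1 hT
    have hmem : eSum e S ∈ f T := hST ▸ Or.inl rfl
    have hv := h.inner_eSum_a S 0
    rw [if_pos hS0] at hv
    rcases hmem with heq | heq | heq | heq | heq | heq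
    · exact h.eSum_injective heq
    · rw [heq, inner_neg_left, h.inner_eSum_a, if_pos hT0] at hv; norm_num at hv
    · rw [heq, h.inner_eSum_a, if_neg (by simpa using hT0)] at hv; norm_num at hv
    · rw [heq, inner_neg_left, h.inner_eSum_a, if_neg (by simpa using hT0)] at hv; norm_num at hv
    · have := h.eSum_injective heq
      rw [this] at hS3
      simp at hS3
    · rw [heq, inner_neg_left, h.inner_eSum_a, if_pos (Finset.mem_univ _)] at hv; norm_num at hv
  rw [himage, hinj.ncard_image, Set.ncard_coe_finset]
  decide +kernel

lemma ncard_triplesIII : (triplesIII e).ncard = 90 := by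
  -- The two 3-sets of a triple play symmetric roles: they are U ∪ {i} and U ∪ {j} with |U| = 2.
  -- Ordering i < j removes the repetition and leaves C(6,2) · C(4,2) = 90.
  let A : Finset ((Fin 6 × Fin 6) × Finset (Fin 6)) := Finset.univ.filter fun p =>
    p.1.1 < p.1.2 ∧ p.2.card = 2 ∧ p.1.1 ∉ p.2 ∧ p.1.2 ∉ p.2
  let f : (Fin 6 × Fin 6) × Finset (Fin 6) → Set (EuclideanSpace ℝ (Fin 6)) := fun p =>
    signedTriple (eSum e (insert p.1.1 p.2)) (e p.1.1 - e p.1.2) (eSum e (insert p.1.2 p.2))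
  have hA : ∀ {i j U}, ((i, j), U) ∈ (A : Set ((Fin 6 × Fin 6) × Finset (Fin 6))) ↔
      i < j ∧ U.card = 2 ∧ i ∉ U ∧ j ∉ U := by
    intro i j U
    simp [A]
  have himage : triplesIII e = f '' A := by
    ext T
    constructor
    · rintro ⟨S, i, j, hS, hi, hj, rfl⟩
      have hij : i ≠ j := fun hij => hj (hij ▸ hi)
      have hU : (S.erase i).card = 2 := by rw [Finset.card_erase_of_mem hi, hS]
      have hjU : j ∉ S.erase i := fun hj' => hj (Finset.mem_of_mem_erase hj')
      have h1 := eSum_insert_erase e hi hj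
      rcases lt_or_gt_of_ne hij with hlt | hlt
      · refine ⟨((i, j), S.erase i), hA.2 ⟨hlt, hU, Finset.notMem_erase i S, hjU⟩, ?_⟩
        simp only [f, Finset.insert_erase hi, h1]
      · refine ⟨((j, i), S.erase i), hA.2 ⟨hlt, hU, hjU, Finset.notMem_erase i S⟩, ?_⟩
        simp only [f, Finset.insert_erase hi, h1]
        rw [signedTriple_rotate, signedTriple_swap, ← signedTriple_neg_mid, neg_sub]
    · rintro ⟨⟨⟨i, j⟩, U⟩, hU, rfl⟩
      obtain ⟨hij, hU2, hi, hj⟩ := hA.1 hU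
      have hj' : j ∉ insert i U := by simp [hij.ne', hj]
      refine ⟨insert i U, i, j, by rw [Finset.card_insert_of_notMem hi, hU2],
        Finset.mem_insert_self i U, hj', ?_⟩
      rw [← eSum_insert_erase e (Finset.mem_insert_self i U) hj', Finset.erase_insert hi]
  have hinj : Set.InjOn f A := by
    rintro ⟨⟨i, j⟩, U⟩ hp ⟨⟨k, l⟩, W⟩ hq hpq
    obtain ⟨hij, hU2, hi, hj⟩ := hA.1 hp
    obtain ⟨hkl, hW2, hk, hl⟩ := hA.1 hq
    have hcU : (insert i U).card = 3 := by rw [Finset.card_insert_of_notMem hi, hU2]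
    have hck : (insert k W).card = 3 := by rw [Finset.card_insert_of_notMem hk, hW2]
    have hcl : (insert l W).card = 3 := by rw [Finset.card_insert_of_notMem hl, hW2]
    -- Up to sign, the difference is the only member of degree 0; the order of the indices fixes the
    -- sign.
    obtain ⟨rfl, rfl⟩ : i = k ∧ j = l := by
      have hmem : e i - e j ∈ f ((k, l), W) := hpq ▸ Or.inr (Or.inr (Or.inl rfl))
      have hv := h.inner_sub_sum_a i j
      rcases hmem with heq | heq | heq | heq | heq | heq
      · rw [heq, h.inner_eSum_sum_a, hck] at hv; norm_num at hv
      · rw [heq, inner_neg_left, h.inner_eSum_sum_a, hck] at hv; norm_num at hv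
      · exact h.sub_inj hij.ne heq
      · rw [neg_sub] at heq
        obtain ⟨rfl, rfl⟩ := h.sub_inj hij.ne heq
        exact absurd hij hkl.not_gt
      · rw [heq, h.inner_eSum_sum_a, hcl] at hv; norm_num at hv
      · rw [heq, inner_neg_left, h.inner_eSum_sum_a, hcl] at hv; norm_num at hv
    have hmem : eSum e (insert i U) ∈ f ((i, j), W) := hpq ▸ Or.inl rfl
    have hv := h.inner_eSum_sum_a (insert i U)
    rw [hcU] at hv
    have hUW : insert i U = insert i W := by
      rcases hmem with heq | heq | heq | heq | heq | heq
      · exact h.eSum_injective heq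
      · rw [heq, inner_neg_left, h.inner_eSum_sum_a, hck] at hv; norm_num at hv
      · rw [heq, h.inner_sub_sum_a] at hv; norm_num at hv
      · rw [heq, inner_neg_left, h.inner_sub_sum_a] at hv; norm_num at hv
      · have heq := h.eSum_injective heq
        have hmem : i ∈ insert j W := heq ▸ Finset.mem_insert_self i U
        simp [hij.ne, hk] at hmem
      · rw [heq, inner_neg_left, h.inner_eSum_sum_a, hcl] at hv; norm_num at hv
    rw [← Finset.erase_insert hi, hUW, Finset.erase_insert hk]
  rw [himage, hinj.ncard_image, Set.ncard_coe_finset]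
  decide +kernel

lemma inner_sum_a_of_mem_triplesI {T : Set (EuclideanSpace ℝ (Fin 6))} (hT : T ∈ triplesI e)
    {v : EuclideanSpace ℝ (Fin 6)} (hv : v ∈ T) : inner ℝ v (∑ k, a k) = (0 : ℝ) := by
  obtain ⟨i, j, k, -, -, -, rfl⟩ := hT
  rcases hv with rfl | rfl | rfl | rfl | rfl | rfl <;>
    simp only [neg_sub, h.inner_sub_sum_a]

lemma disjoint_triplesI_triplesII : Disjoint (triplesI e) (triplesII e) := by
  rw [Set.disjoint_left]
  rintro T hT ⟨S, hS, rfl⟩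
  have := h.inner_sum_a_of_mem_triplesI hT (Or.inl rfl)
  rw [h.inner_eSum_sum_a, hS] at this
  norm_num at this

lemma disjoint_triplesI_triplesIII : Disjoint (triplesI e) (triplesIII e) := by
  rw [Set.disjoint_left]
  rintro T hT ⟨S, i, j, hS, -, -, rfl⟩
  have := h.inner_sum_a_of_mem_triplesI hT (Or.inl rfl)
  rw [h.inner_eSum_sum_a, hS] at this
  norm_num at this

/-- The root e(I₆) has degree 6, while the members of a triple of family (iii) have degree 0 or ±3.
-/
lemma disjoint_triplesII_triplesIII : Disjoint (triplesII e) (triplesIII e) := by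
  rw [Set.disjoint_left]
  rintro T ⟨S, hS, rfl⟩ ⟨U, i, j, hU, hi, hj, heq⟩
  have hmem : eSum e Finset.univ ∈ signedTriple (eSum e U) (e i - e j) (eSum e U - e i + e j) :=
    heq ▸ Or.inr (Or.inr (Or.inr (Or.inr (Or.inl rfl))))
  have hv := h.inner_eSum_sum_a Finset.univ
  have h1 := h.inner_eSum_sum_a U
  have h2 := h.inner_sub_sum_a i j
  rw [Finset.card_univ, Fintype.card_fin] at hv
  rw [hU] at h1
  rw [inner_sub_left] at h2
  push_cast at hv h1
  simp only [signedTriple, Set.mem_insert_iff, Set.mem_singleton_iff] at hmem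
  rcases hmem with heq | heq | heq | heq | heq | heq <;> rw [heq] at hv <;>
    try simp only [inner_neg_left, inner_add_left, inner_sub_left] at hv
  all_goals linarith

end IsE6Pair

end E6Triples

end

theorem mainTheorem7
    (a e : Fin 6 → EuclideanSpace ℝ (Fin 6))
    (ha : ∀ i j, inner ℝ (a i) (a j) = if i = j then (4 / 3 : ℝ) else 1 / 3)
    (he : ∀ i j, inner ℝ (e i) (a j) = if i = j then (1 : ℝ) else 0) :
    (∀ T ∈ triplesI e ∪ triplesII e ∪ triplesIII e, ∀ s ∈ T, IsFacetVector (latticeE6 a) s) ∧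
    Set.BijOn (generatedFacets (latticeE6 a)) (triplesI e ∪ triplesII e ∪ triplesIII e)
      {B | IsBelt (voronoiPolytope (latticeE6 a)) 6 B} ∧
    (triplesI e).ncard = 20 ∧ (triplesII e).ncard = 10 ∧ (triplesIII e).ncard = 90 ∧
    Disjoint (triplesI e) (triplesII e) ∧ Disjoint (triplesI e) (triplesIII e) ∧
    Disjoint (triplesII e) (triplesIII e) ∧
    {B | IsBelt (voronoiPolytope (latticeE6 a)) 6 B}.ncard = 120 := by
  have h : IsE6Pair a e := ⟨ha, he⟩
  have hL := h.isRootLattice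
  have hroots : ∀ T ∈ triplesI e ∪ triplesII e ∪ triplesIII e,
      T ⊆ latticeRoots (latticeE6 a) := by
    intro T hT
    obtain ⟨r, hr, s, hs, hrs, rfl⟩ := h.exists_roots_of_mem_triplesE6 hT
    exact signedTriple_subset_latticeRoots hr hs (sub_mem_latticeRoots hr hs hrs)
  have hbij : Set.BijOn (generatedFacets (latticeE6 a)) (triplesI e ∪ triplesII e ∪ triplesIII e)
      {B | IsBelt (voronoiPolytope (latticeE6 a)) 6 B} := by
    refine ⟨fun T hT => ?_, fun T hT U hU hTU => ?_, fun B hB => ?_⟩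
    · obtain ⟨r, hr, s, hs, hrs, rfl⟩ := h.exists_roots_of_mem_triplesE6 hT
      exact hL.isBelt_generatedFacets hr hs hrs
    -- Facets determine their roots, so a set of facets determines the signed triple.
    · exact (hL.sharedFace_injOn.image_eq_image_iff (hroots T hT) (hroots U hU)).1 hTU
    · obtain ⟨r, hr, s, hs, hrs, rfl⟩ := hL.exists_generatedFacets_eq_of_isBelt hB
      rw [h.latticeRoots_eq] at hr hs
      exact ⟨_, h.signedTriple_mem_of_inner_eq_one hr hs hrs, rfl⟩
  have hI := h.ncard_triplesI
  have hII := h.ncard_triplesII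
  have hIII := h.ncard_triplesIII
  have h12 := h.disjoint_triplesI_triplesII
  have h13 := h.disjoint_triplesI_triplesIII
  have h23 := h.disjoint_triplesII_triplesIII
  refine ⟨fun T hT s hs => ⟨(hroots T hT hs).1, hL.isFacetOf_sharedFace (hroots T hT hs)⟩, hbij,
    hI, hII, hIII, h12, h13, h23, ?_⟩
  have f1 : (triplesI e).Finite := Set.finite_of_ncard_ne_zero (by omega)
  have f2 : (triplesII e).Finite := Set.finite_of_ncard_ne_zero (by omega)
  have f3 : (triplesIII e).Finite := Set.finite_of_ncard_ne_zero (by omega)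
  rw [← hbij.image_eq, hbij.injOn.ncard_image,
    Set.ncard_union_eq (Set.disjoint_union_left.2 ⟨h13, h23⟩) (f1.union f2) f3,
    Set.ncard_union_eq h12 f1 f2, hI, hII, hIII]
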